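/- Let $(\Sigma,\partial)$ be a differential field whose field of constants $\mathbf{C}$ is algebraically closed of characteristic $0$. Let $\lambda,\mu$ be algebraic variables with $\partial\lambda=\partial\mu=0$, so that $\Sigma[\lambda,\mu]$ is a differential ring. Let $P,Q\in\Sigma[\partial]\setminus\mathbf{C}[\partial]$ be commuting ordinary differential operators of positive orders $n$ and $m$, let $a_n$ be the leading coefficient of $P$, and let $h=\partial\mathrm{Res}(P-\lambda,Q-\mu)\in\Sigma[\lambda,\mu]$ be the differential resultant, that is, the determinant of the $(n+m)\times(n+m)$ matrix whose rows are the coefficients of $\partial^{m-1}(P-\lambda),\dots,P-\lambda,\partial^{n-1}(Q-\mu),\dots,Q-\mu$ in the basis $\partial^{n+m-1},\dots,\partial,1$. Then $h=a_n^m h_0$ for some nonzero $h_0\in\mathbf{C}[\lambda,\mu]$. Whenever $h=c\,h_0$ with $c\in\Sigma\setminus\{0\}$ and $h_0\in\mathbf{C}[\lambda,\mu]$, the polynomial $h_0$ has a square-free part $f\in\mathbf{C}[\lambda,\mu]$ (the square-free part of $h$, unique up to a nonzero constant factor: $f$ is square-free, $f\mid h_0$, and $h_0$ divides a power of $f$),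 and every such $f$ satisfies: 1. $f$ is irreducible in $\mathbf{C}[\lambda,\mu]$ and the Burchnall–Chaundy ideal $\mathrm{BC}(P,Q)=\{g\in\mathbf{C}[\lambda,\mu] : g(P,Q)=0\}$ equals the ideal $(f)$ of $\mathbf{C}[\lambda,\mu]$. 2. Let $(P-\lambda,Q-\mu)$ be the left ideal of $\Sigma[\lambda,\mu][\partial]$ generated by $P-\lambda$ and $Q-\mu$. The radical of the elimination ideal $(P-\lambda,Q-\mu)\cap\mathbf{C}[\lambda,\mu]$ equals $(f)$. 3. The radical of the elimination ideal $(P-\lambda,Q-\mu)\cap\Sigma[\lambda,\mu]$ equals the differential ideal $[f]$ of $\Sigma[\lambda,\mu]$ generated by $f$, which is also the ideal of $\Sigma[\lambda,\mu]$ generated by $f$. -/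

import Mathlib

open scoped Differential

noncomputable section

/-- The field of constants of a differential field. -/
def constants (K : Type*) [Field K] [Differential K] : Subfield K where
  carrier := {x | x′ = 0}
  mul_mem' := by
    intro a b ha hb
    have ha' : a′ = 0 := ha
    have hb' : b′ = 0 := hb
    simp [Derivation.leibniz, ha', hb']
  one_mem' := by simp
  add_mem' := by
    intro a b ha hb
    have ha' : a′ = 0 := ha
    have hb' : b′ = 0 := hb
    simp [ha', hb']
  zero_mem' := by simp
  neg_mem' := by
    intro a ha
    have ha' : a′ = 0 := ha
    simp [ha']
  inv_mem' := by
    intro a ha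
    have ha' : a′ = 0 := ha
    simp [Derivation.leibniz_inv, ha']

/-! ### The derivation on polynomials with algebraic (constant) variables -/

/-- Derivation of the coefficients of a multivariate polynomial; the variables are constants. -/
def mvCoeffDeriv {σ R : Type*} [CommRing R] [Differential R] (p : MvPolynomial σ R) :
    MvPolynomial σ R :=
  ∑ s ∈ p.support, MvPolynomial.monomial s (p.coeff s)′

theorem coeff_mvCoeffDeriv {σ R : Type*} [CommRing R] [Differential R] (p : MvPolynomial σ R)
    (s : σ →₀ ℕ) : (mvCoeffDeriv p).coeff s = (p.coeff s)′ := by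
  classical
  unfold mvCoeffDeriv
  rw [MvPolynomial.coeff_sum]
  simp only [MvPolynomial.coeff_monomial]
  rw [Finset.sum_ite_eq' p.support s]
  split_ifs with h
  · rfl
  · rw [MvPolynomial.notMem_support_iff.mp h]; simp

instance instDifferentialMvPolynomial {σ R : Type*} [CommRing R] [Differential R] :
    Differential (MvPolynomial σ R) where
  deriv := Derivation.mk'
    (AddMonoidHom.toIntLinearMap
      { toFun := mvCoeffDeriv
        map_zero' := by ext s; simp [coeff_mvCoeffDeriv]
        map_add' := by intro p q; ext s; simp [coeff_mvCoeffDeriv] })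
    (by
      classical
      intro p q
      ext s
      change (mvCoeffDeriv (p * q)).coeff s = (p * mvCoeffDeriv q + q * mvCoeffDeriv p).coeff s
      rw [mul_comm q, MvPolynomial.coeff_add, coeff_mvCoeffDeriv]
      simp only [MvPolynomial.coeff_mul, coeff_mvCoeffDeriv, map_sum, ← Finset.sum_add_distrib]
      refine Finset.sum_congr rfl fun x _ => ?_
      rw [Derivation.leibniz, smul_eq_mul, smul_eq_mul]
      ring)

/-! ### The ring of differential operators -/

/-- The ring `R[∂]` of linear ordinary differential operators over a differential ring `R`.
The operator `∑ aᵢ ∂ⁱ`, with its coefficients on the left, is stored as the polynomial `∑ aᵢ Xⁱ`;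
the product is not that of polynomials, see `DiffOp.mul_def` and `DiffOp.d_mul_C`. -/
def DiffOp (R : Type*) [CommRing R] : Type _ := Polynomial R

namespace DiffOp

section

variable {R : Type*} [CommRing R]

instance instAddCommGroup : AddCommGroup (DiffOp R) :=
  inferInstanceAs (AddCommGroup (Polynomial R))

/-- The polynomial `∑ aᵢ Xⁱ` of the coefficients of the operator `∑ aᵢ ∂ⁱ`. -/
def toPoly : DiffOp R ≃+ Polynomial R := AddEquiv.refl _

/-- The coefficient of `∂ⁱ`. -/
def coeff (P : DiffOp R) (i : ℕ) : R := (toPoly P).coeff i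

/-- The order of an operator (with the value `0` at the zero operator). -/
def order (P : DiffOp R) : ℕ := (toPoly P).natDegree

/-- The leading coefficient of an operator. -/
def leadingCoeff (P : DiffOp R) : R := P.coeff P.order

variable [Differential R]

/-- Left multiplication by `∂` on coefficient polynomials:
`∂ · ∑ aᵢ ∂ⁱ = ∑ (aᵢ′ ∂ⁱ + aᵢ ∂ⁱ⁺¹)`. -/
def dMul : Polynomial R →+ Polynomial R where
  toFun p := p.sum fun i a => Polynomial.monomial i a′ + Polynomial.monomial (i + 1) a
  map_zero' := by simp
  map_add' p q := by
    refine Polynomial.sum_add_index _ _ _ (by simp) ?_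
    intro i a b
    simp only [map_add]
    abel

theorem dMul_monomial (i : ℕ) (a : R) : dMul (Polynomial.monomial i a) =
    Polynomial.monomial i a′ + Polynomial.monomial (i + 1) a := by
  change (Polynomial.monomial i a).sum
    (fun i a => Polynomial.monomial i a′ + Polynomial.monomial (i + 1) a) = _
  rw [Polynomial.sum_monomial_index]
  simp

theorem dMul_C (a : R) : dMul (Polynomial.C a) = Polynomial.C a′ + Polynomial.monomial 1 a :=
  dMul_monomial 0 a

theorem dMul_C_mul (a : R) (p : Polynomial R) :
    dMul (Polynomial.C a * p) = Polynomial.C a′ * p + Polynomial.C a * dMul p := by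
  induction p using Polynomial.induction_on' with
  | add p q hp hq => simp only [mul_add, map_add, hp, hq]; abel
  | monomial i b =>
    simp only [Polynomial.C_mul_monomial, dMul_monomial, mul_add]
    rw [Derivation.leibniz, smul_eq_mul, smul_eq_mul, map_add, mul_comm b]
    abel

/-- The product of coefficient polynomials: `(∑ aᵢ ∂ⁱ) · q = ∑ aᵢ (∂ⁱ · q)`. -/
def act : Polynomial R →+ Polynomial R →+ Polynomial R where
  toFun p :=
    { toFun := fun q => p.sum fun i a => Polynomial.C a * dMul^[i] q
      map_zero' := by simp [Polynomial.sum, iterate_map_zero]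
      map_add' := by
        intro q r
        simp [Polynomial.sum, iterate_map_add, mul_add, Finset.sum_add_distrib] }
  map_zero' := by
    refine AddMonoidHom.ext fun q => ?_
    exact Polynomial.sum_zero_index (fun i (a : R) => Polynomial.C a * dMul^[i] q)
  map_add' p q := by
    refine AddMonoidHom.ext fun r => ?_
    exact Polynomial.sum_add_index p q (fun i (a : R) => Polynomial.C a * dMul^[i] r)
      (by simp) (by intro i a b; simp [add_mul])

theorem act_monomial (i : ℕ) (a : R) (q : Polynomial R) :
    act (Polynomial.monomial i a) q = Polynomial.C a * dMul^[i] q := by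
  change (Polynomial.monomial i a).sum (fun i a => Polynomial.C a * dMul^[i] q) = _
  rw [Polynomial.sum_monomial_index]
  simp

theorem act_C (a : R) (q : Polynomial R) : act (Polynomial.C a) q = Polynomial.C a * q :=
  act_monomial 0 a q

theorem act_C_mul (a : R) (p q : Polynomial R) :
    act (Polynomial.C a * p) q = Polynomial.C a * act p q := by
  induction p using Polynomial.induction_on' with
  | add p r hp hr => simp only [mul_add, map_add, AddMonoidHom.add_apply, hp, hr]
  | monomial i b => simp only [Polynomial.C_mul_monomial, act_monomial, Polynomial.C_mul, mul_assoc]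

theorem act_dMul (p q : Polynomial R) : act (dMul p) q = dMul (act p q) := by
  induction p using Polynomial.induction_on' with
  | add p r hp hr => simp only [map_add, AddMonoidHom.add_apply, hp, hr]
  | monomial i b =>
    simp only [dMul_monomial, map_add, AddMonoidHom.add_apply, act_monomial, dMul_C_mul,
      Function.iterate_succ_apply']

theorem act_act (p q r : Polynomial R) : act (act p q) r = act p (act q r) := by
  induction p using Polynomial.induction_on' with
  | add p s hp hs => simp only [map_add, AddMonoidHom.add_apply, hp, hs]
  | monomial i b =>
    simp only [act_monomial, act_C_mul]
    congr 1
    induction i with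
    | zero => rfl
    | succ i ih => simp only [Function.iterate_succ_apply', act_dMul, ih]

theorem one_act (q : Polynomial R) : act 1 q = q := by
  rw [← Polynomial.monomial_zero_one, act_monomial]
  simp

theorem act_one (p : Polynomial R) : act p 1 = p := by
  have key : ∀ i : ℕ, dMul^[i] (1 : Polynomial R) = Polynomial.monomial i 1 := by
    intro i
    induction i with
    | zero => simp
    | succ i ih => rw [Function.iterate_succ_apply', ih, dMul_monomial]; simp
  induction p using Polynomial.induction_on' with
  | add p s hp hs => simp only [map_add, AddMonoidHom.add_apply, hp, hs]
  | monomial i b => rw [act_monomial, key, Polynomial.C_mul_monomial, mul_one]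

instance instRing : Ring (DiffOp R) where
  __ := instAddCommGroup
  mul P Q := toPoly.symm (act (toPoly P) (toPoly Q))
  one := toPoly.symm 1
  mul_assoc P Q S := act_act (toPoly P) (toPoly Q) (toPoly S)
  one_mul P := one_act (toPoly P)
  mul_one P := act_one (toPoly P)
  left_distrib P Q S := map_add (act (toPoly P)) (toPoly Q) (toPoly S)
  right_distrib P Q S := DFunLike.congr_fun (map_add act (toPoly P) (toPoly Q)) (toPoly S)
  zero_mul P := DFunLike.congr_fun (map_zero act) (toPoly P)
  mul_zero P := map_zero (act (toPoly P))

theorem mul_def (P Q : DiffOp R) : toPoly (P * Q) = act (toPoly P) (toPoly Q) := rfl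

/-- The inclusion of `R` in `R[∂]` as the operators of order zero. -/
def C : R →+* DiffOp R where
  toFun a := toPoly.symm (Polynomial.C a)
  map_one' := rfl
  map_zero' := map_zero Polynomial.C
  map_add' a b := map_add Polynomial.C a b
  map_mul' a b := by
    apply toPoly.injective
    rw [mul_def]
    change Polynomial.C (a * b) = act (Polynomial.C a) (Polynomial.C b)
    rw [act_C, Polynomial.C_mul]

/-- The operator `∂`. -/
def d : DiffOp R := toPoly.symm Polynomial.X

/-- The commutation rule `∂ a = a ∂ + a′`. -/
theorem d_mul_C (a : R) : d * C a = C a * d + C a′ := by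
  apply toPoly.injective
  rw [map_add, mul_def, mul_def]
  change act Polynomial.X (Polynomial.C a) =
    act (Polynomial.C a) Polynomial.X + Polynomial.C a′
  rw [act_C, ← Polynomial.monomial_one_one_eq_X, act_monomial]
  simp [dMul_C, Polynomial.C_mul_monomial, add_comm]

/-- An operator is the sum of the `aᵢ ∂ⁱ`. -/
theorem eq_sum (P : DiffOp R) : P = ∑ i ∈ Finset.range (P.order + 1), C (P.coeff i) * d ^ i := by
  have hd : ∀ i : ℕ, toPoly (d ^ i : DiffOp R) = Polynomial.monomial i 1 := by
    intro i
    induction i with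
    | zero => rfl
    | succ i ih =>
      rw [pow_succ', mul_def, ih]
      change act Polynomial.X _ = _
      rw [← Polynomial.monomial_one_one_eq_X, act_monomial]
      simp [dMul_monomial]
  apply toPoly.injective
  rw [map_sum]
  have : ∀ i, toPoly (C (P.coeff i) * d ^ i) = Polynomial.monomial i (P.coeff i) := by
    intro i
    rw [mul_def, hd]
    change act (Polynomial.C _) _ = _
    rw [← Polynomial.monomial_zero_left, act_monomial]
    simp [Polynomial.C_mul_monomial]
  simp only [this]
  exact Polynomial.as_sum_range (toPoly P)

/-- The operator belongs to `C[∂]`, with `C` the constants: all its coefficients are constant. -/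
def HasConstCoeffs (P : DiffOp R) : Prop := ∀ i, (P.coeff i)′ = 0

/-- The differential Sylvester matrix of `P` and `Q`, of orders `n` and `m`: its rows are the
coefficients of `∂ᵐ⁻¹ P, …, ∂ P, P, ∂ⁿ⁻¹ Q, …, ∂ Q, Q` in the basis `∂ⁿ⁺ᵐ⁻¹, …, ∂, 1`. -/
def sylvester (P Q : DiffOp R) :
    Matrix (Fin (Q.order + P.order)) (Fin (Q.order + P.order)) R :=
  Matrix.of fun i j =>
    Fin.addCases (motive := fun _ => DiffOp R)
      (fun k : Fin Q.order => d ^ (Q.order - 1 - (k : ℕ)) * P)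
      (fun k : Fin P.order => d ^ (P.order - 1 - (k : ℕ)) * Q) i
      |>.coeff (Q.order + P.order - 1 - (j : ℕ))

/-- The differential (Sylvester) resultant `∂Res(P, Q)`. -/
def dRes (P Q : DiffOp R) : R := (sylvester P Q).det

end

end DiffOp

/-! ### Commuting pairs: Burchnall-Chaundy ideal and elimination ideals

The variables `λ` and `μ` are `X 0` and `X 1`. -/

section

variable {K : Type*} [Field K] [Differential K]

/-- The inclusion of `C[λ, μ]` in `K[λ, μ]`, with `C` the field of constants of `K`. -/
def constIncl (K : Type*) [Field K] [Differential K] :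
    MvPolynomial (Fin 2) (constants K) →+* MvPolynomial (Fin 2) K :=
  MvPolynomial.map (constants K).subtype

/-- An operator over `K`, viewed as an operator over `K[λ, μ]`. -/
def extendCoeffs (P : DiffOp K) : DiffOp (MvPolynomial (Fin 2) K) :=
  DiffOp.toPoly.symm ((DiffOp.toPoly P).map MvPolynomial.C)

/-- `P - λ` as an operator over `K[λ, μ]`. -/
def subLambda (P : DiffOp K) : DiffOp (MvPolynomial (Fin 2) K) :=
  extendCoeffs P - DiffOp.C (MvPolynomial.X 0)

/-- `Q - μ` as an operator over `K[λ, μ]`. -/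
def subMu (Q : DiffOp K) : DiffOp (MvPolynomial (Fin 2) K) :=
  extendCoeffs Q - DiffOp.C (MvPolynomial.X 1)

/-- The polynomial `h(λ, μ) = ∂Res(P - λ, Q - μ)` in `K[λ, μ]`. -/
def spectralRes (P Q : DiffOp K) : MvPolynomial (Fin 2) K :=
  DiffOp.dRes (subLambda P) (subMu Q)

/-- The value `g(P, Q) = ∑ cᵢⱼ Pⁱ Qʲ` of the polynomial `g = ∑ cᵢⱼ λⁱ μʲ` with constant
coefficients. -/
def evalPair (P Q : DiffOp K) (g : MvPolynomial (Fin 2) (constants K)) : DiffOp K :=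
  ∑ s ∈ g.support, DiffOp.C ((constants K).subtype (g.coeff s)) * (P ^ s 0 * Q ^ s 1)

theorem evalPair_eq_sum (P Q : DiffOp K) (g : MvPolynomial (Fin 2) (constants K))
    {t : Finset (Fin 2 →₀ ℕ)} (ht : g.support ⊆ t) :
    evalPair P Q g = ∑ s ∈ t, DiffOp.C ((constants K).subtype (g.coeff s)) * (P ^ s 0 * Q ^ s 1) := by
  refine Finset.sum_subset ht fun s _ hs => ?_
  rw [MvPolynomial.notMem_support_iff.mp hs]
  simp

theorem evalPair_add (P Q : DiffOp K) (g h : MvPolynomial (Fin 2) (constants K)) :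
    evalPair P Q (g + h) = evalPair P Q g + evalPair P Q h := by
  classical
  rw [evalPair_eq_sum P Q (g + h) (MvPolynomial.support_add (p := g) (q := h)),
    evalPair_eq_sum P Q g (Finset.subset_union_left (s₂ := h.support)),
    evalPair_eq_sum P Q h (Finset.subset_union_right (s₁ := g.support)),
    ← Finset.sum_add_distrib]
  simp [add_mul]

theorem evalPair_monomial (P Q : DiffOp K) (s : Fin 2 →₀ ℕ) (c : constants K) :
    evalPair P Q (MvPolynomial.monomial s c) = DiffOp.C ((constants K).subtype c) * (P ^ s 0 * Q ^ s 1) := by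
  classical
  rw [evalPair_eq_sum P Q _ MvPolynomial.support_monomial_subset]
  simp

theorem evalPair_C_mul (P Q : DiffOp K) (c : constants K)
    (g : MvPolynomial (Fin 2) (constants K)) :
    evalPair P Q (MvPolynomial.C c * g) = DiffOp.C ((constants K).subtype c) * evalPair P Q g := by
  induction g using MvPolynomial.induction_on' with
  | monomial s b =>
    rw [MvPolynomial.C_mul_monomial, evalPair_monomial, evalPair_monomial]
    simp [mul_assoc]
  | add p q hp hq => rw [mul_add, evalPair_add, evalPair_add, hp, hq, mul_add]

theorem evalPair_mul_X (P Q : DiffOp K) (hPQ : Commute P Q) (i : Fin 2)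
    (g : MvPolynomial (Fin 2) (constants K)) :
    evalPair P Q (g * MvPolynomial.X i) = evalPair P Q g * ![P, Q] i := by
  induction g using MvPolynomial.induction_on' with
  | monomial s b =>
    rw [MvPolynomial.X, MvPolynomial.monomial_mul, evalPair_monomial, evalPair_monomial, mul_one,
      mul_assoc]
    congr 1
    fin_cases i
    · have h : Commute P (Q ^ s 1) := hPQ.pow_right _
      simp [pow_succ, mul_assoc, h.eq]
    · simp [pow_succ, mul_assoc]
  | add p q hp hq => rw [add_mul, evalPair_add, evalPair_add, hp, hq, add_mul]

/-- The Burchnall-Chaundy ideal `BC(P, Q) = {g ∈ C[λ, μ] | g(P, Q) = 0}` of a commuting pair. -/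
def bcIdeal (P Q : DiffOp K) (hPQ : Commute P Q) :
    Ideal (MvPolynomial (Fin 2) (constants K)) where
  carrier := {g | evalPair P Q g = 0}
  add_mem' := by
    intro g h hg hh
    have hg' : evalPair P Q g = 0 := hg
    have hh' : evalPair P Q h = 0 := hh
    simp [evalPair_add, hg', hh']
  zero_mem' := by simp [evalPair]
  smul_mem' := by
    intro a g hg
    have hg' : evalPair P Q g = 0 := hg
    change evalPair P Q (a * g) = 0
    induction a using MvPolynomial.induction_on with
    | C c => rw [evalPair_C_mul, hg', mul_zero]
    | add p q hp hq => rw [add_mul, evalPair_add, hp, hq, add_zero]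
    | mul_X p i hp => rw [mul_right_comm, evalPair_mul_X P Q hPQ, hp, zero_mul]

/-- The left ideal `(P - λ, Q - μ)` of `K[λ, μ][∂]`. -/
def leftIdealPair (P Q : DiffOp K) : Ideal (DiffOp (MvPolynomial (Fin 2) K)) :=
  Ideal.span {subLambda P, subMu Q}

/-- The elimination ideal `(P - λ, Q - μ) ∩ K[λ, μ]`. -/
def elimIdeal (P Q : DiffOp K) : Ideal (MvPolynomial (Fin 2) K) :=
  (leftIdealPair P Q).comap DiffOp.C

/-- The elimination ideal `(P - λ, Q - μ) ∩ C[λ, μ]`. -/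
def elimIdealConst (P Q : DiffOp K) : Ideal (MvPolynomial (Fin 2) (constants K)) :=
  (elimIdeal P Q).comap (constIncl K)

end

/-- `f` is a square-free part of `h`: it is square-free and has the same irreducible factors. -/
def IsSquarefreePart {A : Type*} [CommRing A] (f h : A) : Prop :=
  Squarefree f ∧ f ∣ h ∧ ∃ k : ℕ, h ∣ f ^ k

/-- The differential ideal `[f]` generated by `f`: the least ideal that contains `f` and is
stable under the derivation. -/
def differentialIdeal {A : Type*} [CommRing A] [Differential A] (f : A) : Ideal A :=
  sInf {I | f ∈ I ∧ ∀ x ∈ I, x′ ∈ I}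

end

/-! Write `C` for the constants and `K` for the differential field. The map `a λⁱ μʲ ∂ᵏ ↦ a ∂ᵏ Pⁱ
Qʲ` is only additive, but for commuting `P`, `Q` its kernel is exactly the left ideal `(P - λ, Q -
μ)` (`mem_leftIdealPair_iff`). Hence the elimination ideals are kernels of evaluation at `(P, Q)`,
and the one in `C[λ, μ]`, where evaluation is multiplicative, is `BC(P, Q)`.

On `K[λ, μ]` evaluation is not multiplicative, but its leading coefficients are. Two operators of
equal order commuting with `P` have leading coefficients with constant ratio
(`wronskian_coeff_eq_zero`). So a polynomial over `K` whose value has order less than `N` is a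
`K`-combination of constant polynomials with the same bound (`mem_orderSpan_iff`). This makes the
elimination ideal prime and, for `N = 0`, generated by `BC(P, Q)`.

Cramer's rule puts the resultant `h` in the elimination ideal, and its coefficient of `μⁿ` is `± aₙᵐ
≠ 0`, so `BC(P, Q)` is a nonzero prime. It contains no `λ - c` since `P` has positive order; by the
Nullstellensatz it is not maximal, so it has height one and is generated by an irreducible `p`.

Conversely, each `p ∂ʲ` with `j < n + m` lies in the left ideal and is a combination of the
Sylvester rows. Taking determinants, `h` divides `p ^ (n + m)`. As `p` stays prime in `K[λ, μ]`, `h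
= a pʳ` with `a ∈ K` and `r ≠ 0`; the coefficient of `μⁿ` identifies `a` with `aₙᵐ` up to a
constant. Every square-free part of `h₀` is then an associate of `p`, and the ideals in question,
being prime, are radical. -/

noncomputable section

/-! ### Orders, leading coefficients and right division of operators -/

namespace DiffOp

section

variable {R : Type*} [CommRing R]

@[ext]
theorem ext {A B : DiffOp R} (h : ∀ i, A.coeff i = B.coeff i) : A = B :=
  toPoly.injective (Polynomial.ext h)

/-- The coefficient of `∂ⁱ` as an additive map. -/
def coeffHom (R : Type*) [CommRing R] (i : ℕ) : DiffOp R →+ R where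
  toFun A := A.coeff i
  map_zero' := Polynomial.coeff_zero i
  map_add' A B := Polynomial.coeff_add (toPoly A) (toPoly B) i

theorem coeff_zero (i : ℕ) : (0 : DiffOp R).coeff i = 0 := (coeffHom R i).map_zero

theorem coeff_add (A B : DiffOp R) (i : ℕ) : (A + B).coeff i = A.coeff i + B.coeff i :=
  (coeffHom R i).map_add A B

theorem coeff_sub (A B : DiffOp R) (i : ℕ) : (A - B).coeff i = A.coeff i - B.coeff i :=
  (coeffHom R i).map_sub A B

theorem coeff_sum {ι : Type*} (s : Finset ι) (f : ι → DiffOp R) (i : ℕ) :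
    (∑ x ∈ s, f x).coeff i = ∑ x ∈ s, (f x).coeff i :=
  map_sum (coeffHom R i) f s

theorem coeff_eq_zero_of_order_lt {A : DiffOp R} {i : ℕ} (h : A.order < i) : A.coeff i = 0 :=
  Polynomial.coeff_eq_zero_of_natDegree_lt h

/-- The operator has order less than `N`. -/
def OrderLT (A : DiffOp R) (N : ℕ) : Prop := ∀ k, N ≤ k → A.coeff k = 0

theorem orderLT_order_succ (A : DiffOp R) : A.OrderLT (A.order + 1) :=
  fun _ hk => coeff_eq_zero_of_order_lt hk

theorem OrderLT.mono {A : DiffOp R} {M N : ℕ} (h : A.OrderLT M) (hMN : M ≤ N) : A.OrderLT N :=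
  fun k hk => h k (hMN.trans hk)

theorem OrderLT.add {A B : DiffOp R} {N : ℕ} (hA : A.OrderLT N) (hB : B.OrderLT N) :
    (A + B).OrderLT N :=
  fun k hk => by rw [coeff_add, hA k hk, hB k hk, add_zero]

theorem OrderLT.sub {A B : DiffOp R} {N : ℕ} (hA : A.OrderLT N) (hB : B.OrderLT N) :
    (A - B).OrderLT N :=
  fun k hk => by rw [coeff_sub, hA k hk, hB k hk, sub_zero]

theorem OrderLT.of_succ {A : DiffOp R} {N : ℕ} (hA : A.OrderLT (N + 1)) (h : A.coeff N = 0) :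
    A.OrderLT N :=
  fun k hk => (Nat.eq_or_lt_of_le hk).elim (fun e => e ▸ h) (hA k)

theorem OrderLT.eq_zero {A : DiffOp R} (hA : A.OrderLT 0) : A = 0 :=
  ext fun i => by rw [hA i (Nat.zero_le i), coeff_zero]

theorem leadingCoeff_ne_zero {A : DiffOp R} (h : A ≠ 0) : A.leadingCoeff ≠ 0 :=
  fun h0 => h (toPoly.injective ((Polynomial.leadingCoeff_eq_zero (p := toPoly A)).mp h0))

theorem ne_zero_of_order_pos {A : DiffOp R} (h : 0 < A.order) : A ≠ 0 := by
  rintro rfl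
  exact h.ne' (Polynomial.natDegree_zero (R := R))

variable [Differential R]

theorem toPoly_C_mul (a : R) (A : DiffOp R) : toPoly (C a * A) = Polynomial.C a * toPoly A :=
  act_C a (toPoly A)

theorem toPoly_d_mul (A : DiffOp R) : toPoly (d * A) = dMul (toPoly A) := by
  rw [mul_def]
  change act Polynomial.X _ = _
  rw [← Polynomial.monomial_one_one_eq_X, act_monomial]
  simp

theorem coeff_C_mul (a : R) (A : DiffOp R) (i : ℕ) : (C a * A).coeff i = a * A.coeff i := by
  unfold coeff
  rw [toPoly_C_mul, Polynomial.coeff_C_mul]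

theorem coeff_C_zero (a : R) : (C a : DiffOp R).coeff 0 = a := Polynomial.coeff_C_zero

theorem coeff_C_succ (a : R) (i : ℕ) : (C a : DiffOp R).coeff (i + 1) = 0 :=
  Polynomial.coeff_C_succ

theorem coeff_dMul_zero (p : Polynomial R) : (dMul p).coeff 0 = (p.coeff 0)′ := by
  induction p using Polynomial.induction_on' with
  | add p q hp hq => simp [hp, hq]
  | monomial i a =>
    rw [dMul_monomial]
    rcases i with _ | i <;> simp [Polynomial.coeff_monomial]

theorem coeff_dMul_succ (p : Polynomial R) (k : ℕ) :
    (dMul p).coeff (k + 1) = (p.coeff (k + 1))′ + p.coeff k := by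
  induction p using Polynomial.induction_on' with
  | add p q hp hq => simp only [map_add, Polynomial.coeff_add, hp, hq]; abel
  | monomial i a =>
    rw [dMul_monomial]
    simp only [Polynomial.coeff_add, Polynomial.coeff_monomial, add_left_inj]
    split_ifs <;> simp

theorem coeff_d_mul_zero (A : DiffOp R) : (d * A).coeff 0 = (A.coeff 0)′ := by
  unfold coeff
  rw [toPoly_d_mul, coeff_dMul_zero]

theorem coeff_d_mul_succ (A : DiffOp R) (k : ℕ) :
    (d * A).coeff (k + 1) = (A.coeff (k + 1))′ + A.coeff k := by
  unfold coeff
  rw [toPoly_d_mul, coeff_dMul_succ]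

theorem coeff_d_pow (i k : ℕ) : (d ^ i : DiffOp R).coeff k = if i = k then 1 else 0 := by
  induction i generalizing k with
  | zero =>
    rw [pow_zero, ← map_one C]
    rcases k with _ | k
    · rw [coeff_C_zero, if_pos rfl]
    · rw [coeff_C_succ, if_neg (by omega)]
  | succ i ih =>
    rw [pow_succ']
    rcases k with _ | k
    · rw [coeff_d_mul_zero, ih]; split_ifs <;> simp_all
    · rw [coeff_d_mul_succ, ih, ih]
      simp only [add_left_inj]
      split_ifs <;> simp

theorem OrderLT.C_mul {A : DiffOp R} {N : ℕ} (hA : A.OrderLT N) (a : R) : (C a * A).OrderLT N :=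
  fun k hk => by rw [coeff_C_mul, hA k hk, mul_zero]

theorem OrderLT.d_pow_mul {A : DiffOp R} {N : ℕ} (hA : A.OrderLT N) (i : ℕ) :
    (d ^ i * A).OrderLT (N + i) := by
  induction i with
  | zero => simpa using hA
  | succ i ih =>
    intro k hk
    obtain ⟨k, rfl⟩ : ∃ j, k = j + 1 := ⟨k - 1, by omega⟩
    rw [pow_succ', mul_assoc, coeff_d_mul_succ, ih _ (by omega), ih _ (by omega)]
    simp

theorem coeff_d_pow_mul_top {A : DiffOp R} {s : ℕ} (hA : A.OrderLT (s + 1)) (i : ℕ) :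
    (d ^ i * A).coeff (s + i) = A.coeff s := by
  induction i with
  | zero => simp
  | succ i ih =>
    rw [pow_succ', mul_assoc, ← add_assoc, coeff_d_mul_succ, ih,
      (hA.d_pow_mul i) _ (by omega)]
    simp

/-- Leibniz: `∂ⁱ a = a ∂ⁱ + i a′ ∂ⁱ⁻¹ + …`, so only the first derivative of the top coefficient
reaches the second place. -/
theorem coeff_d_pow_mul_subtop {A : DiffOp R} {s : ℕ} (hA : A.OrderLT (s + 2)) (i : ℕ) :
    (d ^ i * A).coeff (s + i) = A.coeff s + i * (A.coeff (s + 1))′ := by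
  induction i with
  | zero => simp
  | succ i ih =>
    rw [pow_succ', mul_assoc, ← add_assoc, coeff_d_mul_succ, ih,
      show s + i + 1 = s + 1 + i by omega, coeff_d_pow_mul_top hA]
    push_cast
    ring

theorem OrderLT.eq_sum {A : DiffOp R} {N : ℕ} (hA : A.OrderLT N) :
    A = ∑ i ∈ Finset.range N, C (A.coeff i) * d ^ i := by
  ext k
  simp only [coeff_sum, coeff_C_mul, coeff_d_pow, mul_ite, mul_one, mul_zero,
    Finset.sum_ite_eq', Finset.mem_range]
  split_ifs with h
  · rfl
  · exact hA k (not_lt.mp h)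

theorem OrderLT.mul {A B : DiffOp R} {a b : ℕ} (hA : A.OrderLT (a + 1)) (hB : B.OrderLT b) :
    (A * B).OrderLT (a + b) := by
  intro k hk
  rw [hA.eq_sum, Finset.sum_mul, coeff_sum]
  refine Finset.sum_eq_zero fun i hi => ?_
  rw [Finset.mem_range] at hi
  rw [mul_assoc, coeff_C_mul, hB.d_pow_mul i k (by omega), mul_zero]

theorem coeff_mul_top {A B : DiffOp R} {a b : ℕ} (hA : A.OrderLT (a + 1))
    (hB : B.OrderLT (b + 1)) : (A * B).coeff (a + b) = A.coeff a * B.coeff b := by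
  conv_lhs => rw [hA.eq_sum, Finset.sum_mul, coeff_sum, Finset.sum_range_succ]
  rw [Finset.sum_eq_zero, zero_add, mul_assoc, coeff_C_mul, add_comm a b, coeff_d_pow_mul_top hB]
  intro i hi
  rw [Finset.mem_range] at hi
  rw [mul_assoc, coeff_C_mul, hB.d_pow_mul i _ (by omega), mul_zero]

/-- Only the two top terms of `A` contribute; the derivative appears when `∂ᵃ⁺¹` passes the leading
coefficient of `B`. -/
theorem coeff_mul_subtop {A B : DiffOp R} {a b : ℕ} (hA : A.OrderLT (a + 2))
    (hB : B.OrderLT (b + 2)) : (A * B).coeff (a + b + 1) =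
      A.coeff (a + 1) * (B.coeff b + (a + 1 : ℕ) * (B.coeff (b + 1))′) +
        A.coeff a * B.coeff (b + 1) := by
  conv_lhs => rw [hA.eq_sum, Finset.sum_mul, coeff_sum, Finset.sum_range_succ,
    Finset.sum_range_succ]
  rw [Finset.sum_eq_zero, zero_add, mul_assoc, coeff_C_mul, mul_assoc, coeff_C_mul,
    show a + b + 1 = b + (a + 1) by omega, coeff_d_pow_mul_subtop hB,
    show b + (a + 1) = b + 1 + a by omega, coeff_d_pow_mul_top hB, add_comm]
  intro i hi
  rw [Finset.mem_range] at hi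
  rw [mul_assoc, coeff_C_mul, hB.d_pow_mul i _ (by omega), mul_zero]

/-- Commuting operators have leading coefficients with proportional logarithmic derivatives. -/
theorem leadingCoeff_relation_of_commute {A B : DiffOp R} {a b : ℕ} (hA : A.OrderLT (a + 2))
    (hB : B.OrderLT (b + 2)) (h : Commute A B) :
    (a + 1 : ℕ) * A.coeff (a + 1) * (B.coeff (b + 1))′ =
      (b + 1 : ℕ) * B.coeff (b + 1) * (A.coeff (a + 1))′ := by
  -- The products without derivatives are symmetric in `A` and `B` and cancel between `A * B` and `B
  -- * A`.
  have e := coeff_mul_subtop hA hB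
  rw [h.eq, add_comm a b, coeff_mul_subtop hB hA] at e
  linear_combination -e

/-- Right division by an operator whose leading coefficient is a unit. -/
theorem exists_eq_mul_add {A : DiffOp R} (hA : IsUnit A.leadingCoeff) (V : DiffOp R) :
    ∃ q r, V = q * A + r ∧ r.OrderLT A.order := by
  obtain ⟨u, hu⟩ := hA
  suffices ∀ (N : ℕ) (V : DiffOp R), V.OrderLT N → ∃ q r, V = q * A + r ∧ r.OrderLT A.order from
    this _ V V.orderLT_order_succ
  intro N
  induction N with
  | zero => exact fun V hV => ⟨0, V, by simp, hV.mono (Nat.zero_le _)⟩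
  | succ N ih =>
    intro V hV
    rcases lt_or_ge N A.order with h | h
    · exact ⟨0, V, by simp, hV.mono h⟩
    · obtain ⟨i, rfl⟩ := Nat.exists_eq_add_of_le h
      have hA1 := A.orderLT_order_succ
      obtain ⟨q, r, e, hr⟩ := ih
        (V - C (V.coeff (A.order + i) * ((u⁻¹ : Rˣ) : R)) * (d ^ i * A)) <| by
          refine OrderLT.of_succ (hV.sub (((hA1.d_pow_mul i).C_mul _).mono (by omega))) ?_
          rw [coeff_sub, coeff_C_mul, coeff_d_pow_mul_top hA1, mul_assoc]
          change _ - _ * (_ * A.leadingCoeff) = 0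
          simp [← hu]
      refine ⟨q + C (V.coeff (A.order + i) * ((u⁻¹ : Rˣ) : R)) * d ^ i, r, ?_, hr⟩
      rw [add_mul, add_right_comm, ← e, mul_assoc]
      abel

/-- An order bound for a product with an operator of unit leading coefficient passes to the
other factor. -/
theorem OrderLT.of_mul_right {U A : DiffOp R} {N : ℕ} (hA : IsUnit A.leadingCoeff)
    (h : (U * A).OrderLT (N + A.order)) : U.OrderLT N := by
  suffices ∀ M, U.OrderLT M → U.OrderLT N from this _ U.orderLT_order_succ
  intro M
  induction M with
  | zero => exact fun hU => hU.mono (Nat.zero_le _)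
  | succ M ih =>
    intro hU
    rcases lt_or_ge M N with hM | hM
    · exact hU.mono hM
    · refine ih (hU.of_succ ?_)
      have e := coeff_mul_top hU A.orderLT_order_succ
      rw [h _ (by omega)] at e
      exact (hA.mul_left_eq_zero).mp e.symm

/-! ### The resultant and the left ideal of a pair -/

theorem exists_of_mem_span_pair {A B V : DiffOp R} (h : V ∈ Ideal.span {A, B}) :
    ∃ X Y, V = X * A + Y * B := by
  obtain ⟨X, Y, e⟩ := Submodule.mem_span_pair.mp h
  exact ⟨X, Y, e.symm⟩

/-- The operator whose coefficients form the given row of the Sylvester matrix. -/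
def sylvesterRow (A B : DiffOp R) (i : Fin (B.order + A.order)) : DiffOp R :=
  Fin.addCases (motive := fun _ => DiffOp R)
    (fun k : Fin B.order => d ^ (B.order - 1 - (k : ℕ)) * A)
    (fun k : Fin A.order => d ^ (A.order - 1 - (k : ℕ)) * B) i

theorem sylvester_apply (A B : DiffOp R) (i j : Fin (B.order + A.order)) :
    sylvester A B i j = (sylvesterRow A B i).coeff (B.order + A.order - 1 - (j : ℕ)) := rfl

theorem sylvesterRow_orderLT (A B : DiffOp R) (i : Fin (B.order + A.order)) :
    (sylvesterRow A B i).OrderLT (B.order + A.order) := by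
  unfold sylvesterRow
  refine Fin.addCases (fun k => ?_) (fun k => ?_) i
  · rw [Fin.addCases_left]
    exact (A.orderLT_order_succ.d_pow_mul _).mono (by omega)
  · rw [Fin.addCases_right]
    exact (B.orderLT_order_succ.d_pow_mul _).mono (by omega)

theorem sylvesterRow_mem (A B : DiffOp R) (i : Fin (B.order + A.order)) :
    sylvesterRow A B i ∈ Ideal.span {A, B} := by
  unfold sylvesterRow
  refine Fin.addCases (fun k => ?_) (fun k => ?_) i
  · rw [Fin.addCases_left]
    exact Ideal.mul_mem_left _ _ (Ideal.subset_span (by simp))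
  · rw [Fin.addCases_right]
    exact Ideal.mul_mem_left _ _ (Ideal.subset_span (by simp))

/-- The resultant belongs to the left ideal generated by the two operators. -/
theorem C_dRes_mem (A B : DiffOp R) (h : 0 < A.order) :
    C (dRes A B) ∈ Ideal.span {A, B} := by
  -- The last column holds the coefficients of `∂⁰`. Row `l` of `adj S * S = det S • 1` thus says
  -- that this combination of the rows is the operator `det S` of order zero.
  let l : Fin (B.order + A.order) := ⟨B.order + A.order - 1, by omega⟩
  have key : C (dRes A B) =
      ∑ i, C ((sylvester A B).adjugate l i) * sylvesterRow A B i := by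
    have hadj := (sylvester A B).adjugate_mul
    ext k
    simp only [coeff_sum, coeff_C_mul]
    rcases lt_or_ge k (B.order + A.order) with hk | hk
    · have := congrFun (congrFun hadj l) ⟨B.order + A.order - 1 - k, by omega⟩
      simp only [Matrix.mul_apply, sylvester_apply] at this
      rw [show B.order + A.order - 1 - (B.order + A.order - 1 - k) = k by omega] at this
      rw [this]
      rcases k with _ | k
      · simp [coeff_C_zero, l, dRes]
      · rw [coeff_C_succ, Matrix.smul_apply, Matrix.one_apply_ne, smul_zero]
        simp only [l, ne_eq, Fin.mk.injEq]
        omega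
    · obtain ⟨k, rfl⟩ : ∃ j, k = j + 1 := ⟨k - 1, by omega⟩
      rw [coeff_C_succ, Finset.sum_eq_zero]
      intro i _
      rw [sylvesterRow_orderLT A B i _ hk, mul_zero]
  rw [key]
  exact sum_mem fun i _ => Ideal.mul_mem_left _ _ (sylvesterRow_mem A B i)

theorem sum_range_eq_sum_fin_rev {M : Type*} [AddCommMonoid M] (n : ℕ) (f : ℕ → M) :
    ∑ i ∈ Finset.range n, f i = ∑ k : Fin n, f (n - 1 - k) := by
  rw [← Finset.sum_range_reflect, Finset.sum_range]

/-- Elements of small order of the left ideal of a commuting pair are combinations of the rows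
of the Sylvester matrix. -/
theorem exists_eq_sum_sylvesterRow {A B V : DiffOp R} (hAB : Commute A B)
    (hA : IsUnit A.leadingCoeff) (hA0 : 0 < A.order)
    (hV : V ∈ Ideal.span {A, B}) (hord : V.OrderLT (B.order + A.order)) :
    ∃ c : Fin (B.order + A.order) → R, V = ∑ i, C (c i) * sylvesterRow A B i := by
  obtain ⟨X, Y, rfl⟩ := exists_of_mem_span_pair hV
  obtain ⟨q, r, rfl, hr⟩ := exists_eq_mul_add hA Y
  -- Commutation turns `q A B` into `q B A`, so the cofactor of `B` can be replaced by its remainder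
  -- modulo `A`, of order less than that of `A`. The bound on the sum then bounds the cofactor of
  -- `A`.
  have e : X * A + (q * A + r) * B = (X + q * B) * A + r * B := by
    rw [add_mul, add_mul, mul_assoc q, hAB.eq, mul_assoc q, add_assoc]
  rw [e] at hord ⊢
  have hrB : (r * B).OrderLT (B.order + A.order) := by
    have hr' : r.OrderLT (A.order - 1 + 1) := by rwa [Nat.sub_add_cancel hA0]
    exact (hr'.mul B.orderLT_order_succ).mono (by omega)
  have hX : (X + q * B).OrderLT B.order := by
    refine OrderLT.of_mul_right hA ?_
    simpa using hord.sub hrB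
  refine ⟨Fin.addCases (fun k => (X + q * B).coeff (B.order - 1 - k))
    (fun k => r.coeff (A.order - 1 - k)), ?_⟩
  rw [Fin.sum_univ_add]
  simp only [sylvesterRow, Fin.addCases_left, Fin.addCases_right, ← mul_assoc, ← Finset.sum_mul]
  conv_lhs => rw [hX.eq_sum, hr.eq_sum]
  congr 2 <;> exact sum_range_eq_sum_fin_rev _ fun i => C _ * d ^ i

theorem commute_C_of_deriv_eq_zero {x : R} (hx : x′ = 0) (A : DiffOp R) : Commute (C x) A := by
  have hd : Commute (C x) (d : DiffOp R) := by
    have := d_mul_C x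
    rw [hx, map_zero, add_zero] at this
    exact this.symm
  rw [eq_sum A]
  refine Commute.sum_right _ _ _ fun i _ => Commute.mul_right ?_ (hd.pow_right i)
  rw [Commute, SemiconjBy, ← map_mul, ← map_mul, mul_comm]

/-- For a commuting pair, the resultant divides a power of each constant element of the left
ideal. -/
theorem dRes_dvd_pow {A B : DiffOp R} (hAB : Commute A B)
    (hA : IsUnit A.leadingCoeff) (hA0 : 0 < A.order) {x : R} (hx : x′ = 0)
    (h : C x ∈ Ideal.span {A, B}) : dRes A B ∣ x ^ (B.order + A.order) := by
  have key : ∀ j : Fin (B.order + A.order), ∃ c : Fin (B.order + A.order) → R,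
      C x * d ^ (B.order + A.order - 1 - (j : ℕ)) = ∑ i, C (c i) * sylvesterRow A B i := by
    intro j
    refine exists_eq_sum_sylvesterRow hAB hA hA0 ?_ ?_
    · rw [(commute_C_of_deriv_eq_zero hx _).eq]
      exact Ideal.mul_mem_left _ _ h
    · intro k hk
      rw [coeff_C_mul, coeff_d_pow, if_neg (by omega), mul_zero]
  choose N hN using key
  -- The relations for all powers of `∂` together read `N S = x • 1`, whence `det N * det S` is a
  -- power of `x`.
  have e : (Matrix.of N) * sylvester A B = Matrix.scalar _ x := by
    ext i j
    have := congrArg (fun V : DiffOp R => V.coeff (B.order + A.order - 1 - (j : ℕ))) (hN i)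
    simp only [coeff_sum, coeff_C_mul, coeff_d_pow] at this
    rw [Matrix.mul_apply]
    simp only [Matrix.of_apply, sylvester_apply, ← this, Matrix.scalar_apply,
      Matrix.diagonal_apply]
    by_cases hij : i = j
    · simp [hij]
    · rw [if_neg hij, if_neg, mul_zero]
      intro h
      exact hij (Fin.ext (by omega))
  have e' := congrArg Matrix.det e
  rw [Matrix.det_mul, Matrix.scalar_apply, Matrix.det_diagonal, Finset.prod_const,
    Finset.card_univ, Fintype.card_fin] at e'
  exact ⟨_, by rw [← e', mul_comm]; rfl⟩

end

end DiffOp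

end

/-! ### Constant variables and change of the coefficient ring -/

noncomputable section

theorem coeff_deriv_mvPolynomial {σ R : Type*} [CommRing R] [Differential R]
    (p : MvPolynomial σ R) (s : σ →₀ ℕ) : (p′).coeff s = (p.coeff s)′ :=
  coeff_mvCoeffDeriv p s

theorem deriv_mvPolynomial_C {σ R : Type*} [CommRing R] [Differential R] (a : R) :
    (MvPolynomial.C a : MvPolynomial σ R)′ = MvPolynomial.C a′ := by
  classical
  ext s
  rw [coeff_deriv_mvPolynomial, MvPolynomial.coeff_C, MvPolynomial.coeff_C]
  split_ifs <;> simp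

theorem deriv_mvPolynomial_monomial_one {σ R : Type*} [CommRing R] [Differential R]
    (s : σ →₀ ℕ) : (MvPolynomial.monomial s (1 : R))′ = 0 := by
  classical
  ext t
  rw [coeff_deriv_mvPolynomial, MvPolynomial.coeff_monomial]
  split_ifs <;> simp

namespace DiffOp

section

variable {R S : Type*} [CommRing R] [Differential R] [CommRing S] [Differential S]

theorem dMul_map (φ : R →+* S) (hφ : ∀ a, (φ a)′ = φ a′) (p : Polynomial R) :
    dMul (p.map φ) = (dMul p).map φ := by
  ext k
  rcases k with _ | k
  · simp [coeff_dMul_zero, hφ]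
  · simp [coeff_dMul_succ, hφ]

theorem act_map (φ : R →+* S) (hφ : ∀ a, (φ a)′ = φ a′) (p q : Polynomial R) :
    act (p.map φ) (q.map φ) = (act p q).map φ := by
  induction p using Polynomial.induction_on' with
  | add p r hp hr =>
    simp only [Polynomial.map_add, map_add, AddMonoidHom.add_apply, hp, hr]
  | monomial i a =>
    rw [Polynomial.map_monomial, act_monomial, act_monomial, Polynomial.map_mul, Polynomial.map_C]
    congr 1
    induction i with
    | zero => rfl
    | succ i ih =>
      rw [Function.iterate_succ_apply', ih, dMul_map φ hφ,
        ← Function.iterate_succ_apply' (f := ⇑dMul)]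

/-- Functoriality of the ring of differential operators for differential ring homomorphisms. -/
def mapHom (φ : R →+* S) (hφ : ∀ a, (φ a)′ = φ a′) : DiffOp R →+* DiffOp S where
  toFun A := toPoly.symm ((toPoly A).map φ)
  map_zero' := Polynomial.map_zero φ
  map_one' := Polynomial.map_one φ
  map_add' _ _ := Polynomial.map_add φ
  map_mul' A B := (act_map φ hφ (toPoly A) (toPoly B)).symm

end

/-- Left multiplication by scalars. -/
instance instModuleBase {K : Type*} [CommRing K] [Differential K] : Module K (DiffOp K) :=
  Module.compHom (DiffOp K) (C : K →+* DiffOp K)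

theorem smul_eq_C_mul {K : Type*} [CommRing K] [Differential K] (a : K) (A : DiffOp K) :
    a • A = C a * A := rfl

end DiffOp

/-! ### Specialization of `λ`, `μ` to `P`, `Q` and the left ideal as its kernel -/

section

open DiffOp

variable {K : Type*} [Field K] [Differential K]

/-- `extendCoeffs` as a ring homomorphism. -/
def extendHom (K : Type*) [Field K] [Differential K] :
    DiffOp K →+* DiffOp (MvPolynomial (Fin 2) K) :=
  mapHom MvPolynomial.C deriv_mvPolynomial_C

theorem extendHom_apply (P : DiffOp K) : extendHom K P = extendCoeffs P := rfl

theorem coeff_extendHom (P : DiffOp K) (i : ℕ) :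
    (extendHom K P).coeff i = MvPolynomial.C (P.coeff i) :=
  Polynomial.coeff_map _ _

theorem extendHom_C (a : K) : extendHom K (C a) = C (MvPolynomial.C a) :=
  Polynomial.map_C _

theorem extendHom_d : extendHom K d = d := Polynomial.map_X _

theorem commute_C_monomial (s : Fin 2 →₀ ℕ) (A : DiffOp (MvPolynomial (Fin 2) K)) :
    Commute (C (MvPolynomial.monomial s (1 : K))) A :=
  commute_C_of_deriv_eq_zero (deriv_mvPolynomial_monomial_one s) A

theorem commute_C_X (i : Fin 2) (A : DiffOp (MvPolynomial (Fin 2) K)) :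
    Commute (C (MvPolynomial.X i : MvPolynomial (Fin 2) K)) A :=
  commute_C_monomial _ A

/-- Operators over `K[λ, μ]` are sums of products of a monomial in `λ, μ` and an operator
over `K`. -/
theorem diffOp_mvPolynomial_induction {p : DiffOp (MvPolynomial (Fin 2) K) → Prop}
    (hmon : ∀ s T, p (C (MvPolynomial.monomial s 1) * extendHom K T))
    (hadd : ∀ A B, p A → p B → p (A + B)) (A : DiffOp (MvPolynomial (Fin 2) K)) : p A := by
  have hzero : p 0 := by simpa using hmon 0 0
  rw [DiffOp.eq_sum A]
  refine Finset.sum_induction _ p hadd hzero fun k _ => ?_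
  generalize A.coeff k = g
  induction g using MvPolynomial.induction_on' with
  | add f g hf hg => rw [map_add, add_mul]; exact hadd _ _ hf hg
  | monomial s a =>
    have := hmon s (C a * d ^ k)
    rw [map_mul, extendHom_C, map_pow, extendHom_d, ← mul_assoc, ← map_mul, mul_comm,
      MvPolynomial.C_mul_monomial, mul_one] at this
    exact this

/-- The value `∑ aᵢⱼ T Pⁱ Qʲ` at `∑ aᵢⱼ λⁱ μʲ`. -/
def evalAfter (P Q T : DiffOp K) : MvPolynomial (Fin 2) K →ₗ[K] DiffOp K :=
  (MvPolynomial.basisMonomials (Fin 2) K).constr K fun s => T * (P ^ s 0 * Q ^ s 1)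

theorem evalAfter_monomial (P Q T : DiffOp K) (s : Fin 2 →₀ ℕ) (a : K) :
    evalAfter P Q T (MvPolynomial.monomial s a) = C a * (T * (P ^ s 0 * Q ^ s 1)) := by
  have : MvPolynomial.monomial s a = a • MvPolynomial.basisMonomials (Fin 2) K s := by
    simp [MvPolynomial.coe_basisMonomials, MvPolynomial.smul_monomial]
  rw [this, map_smul, evalAfter, Module.Basis.constr_basis, smul_eq_C_mul]

/-- The additive map `K[λ, μ][∂] → K[∂]` with `a λⁱ μʲ ∂ᵏ ↦ a ∂ᵏ Pⁱ Qʲ`. -/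
def specialize (P Q : DiffOp K) : DiffOp (MvPolynomial (Fin 2) K) →+ DiffOp K where
  toFun A := (toPoly A).sum fun k g => evalAfter P Q (d ^ k) g
  map_zero' := Polynomial.sum_zero_index _
  map_add' A B := Polynomial.sum_add_index (toPoly A) (toPoly B) _ (by simp) (by simp)

theorem specialize_C_mul_d_pow (P Q : DiffOp K) (g : MvPolynomial (Fin 2) K) (k : ℕ) :
    specialize P Q (C g * d ^ k) = evalAfter P Q (d ^ k) g := by
  have : toPoly (C g * d ^ k) = Polynomial.monomial k g := by
    ext1 i
    change (C g * d ^ k).coeff i = _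
    rw [coeff_C_mul, coeff_d_pow, Polynomial.coeff_monomial]
    split_ifs <;> simp
  change (toPoly (C g * d ^ k)).sum _ = _
  rw [this]
  exact Polynomial.sum_monomial_index _ _ (by simp)

theorem specialize_C (P Q : DiffOp K) (g : MvPolynomial (Fin 2) K) :
    specialize P Q (C g) = evalAfter P Q 1 g := by
  simpa using specialize_C_mul_d_pow P Q g 0

/-- The powers of `P` and `Q` land to the right of `T`, where right multiplication by `P - λ` or `Q
- μ` acts; this is why specialization kills the left ideal. -/
theorem specialize_monomial_mul (P Q : DiffOp K) (s : Fin 2 →₀ ℕ) (T : DiffOp K) :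
    specialize P Q (C (MvPolynomial.monomial s 1) * extendHom K T) =
      T * (P ^ s 0 * Q ^ s 1) := by
  conv_lhs => rw [DiffOp.eq_sum T]
  conv_rhs => rw [DiffOp.eq_sum T]
  rw [map_sum, Finset.mul_sum, map_sum, Finset.sum_mul]
  refine Finset.sum_congr rfl fun k _ => ?_
  rw [map_mul (extendHom K), extendHom_C, map_pow, extendHom_d, ← mul_assoc, ← map_mul, mul_comm,
    MvPolynomial.C_mul_monomial, mul_one, specialize_C_mul_d_pow, evalAfter_monomial, mul_assoc]

theorem specialize_mul_subLambda (P Q : DiffOp K) (A : DiffOp (MvPolynomial (Fin 2) K)) :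
    specialize P Q (A * subLambda P) = 0 := by
  induction A using diffOp_mvPolynomial_induction with
  | hadd A B hA hB => rw [add_mul, map_add, hA, hB, add_zero]
  | hmon s T =>
    have e : C (MvPolynomial.monomial s 1) * extendHom K T * subLambda P =
        C (MvPolynomial.monomial s 1) * extendHom K (T * P) -
          C (MvPolynomial.monomial (s + Finsupp.single 0 1) 1) * extendHom K T := by
      rw [subLambda, mul_sub, map_mul, mul_assoc, mul_assoc,
        ← (commute_C_X 0 (extendHom K T)).eq, ← mul_assoc (C _) (C _), ← map_mul,
        MvPolynomial.X, MvPolynomial.monomial_mul, mul_one]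
      rfl
    rw [e, map_sub, specialize_monomial_mul, specialize_monomial_mul]
    simp [pow_succ', mul_assoc]

/-- Unlike for `P - λ`, the new factor `Q` lands to the left of `Pⁱ` and has to be moved across it,
which needs `P` and `Q` to commute. -/
theorem specialize_mul_subMu (P Q : DiffOp K) (hPQ : Commute P Q)
    (A : DiffOp (MvPolynomial (Fin 2) K)) : specialize P Q (A * subMu Q) = 0 := by
  induction A using diffOp_mvPolynomial_induction with
  | hadd A B hA hB => rw [add_mul, map_add, hA, hB, add_zero]
  | hmon s T =>
    have e : C (MvPolynomial.monomial s 1) * extendHom K T * subMu Q =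
        C (MvPolynomial.monomial s 1) * extendHom K (T * Q) -
          C (MvPolynomial.monomial (s + Finsupp.single 1 1) 1) * extendHom K T := by
      rw [subMu, mul_sub, map_mul, mul_assoc, mul_assoc,
        ← (commute_C_X 1 (extendHom K T)).eq, ← mul_assoc (C _) (C _), ← map_mul,
        MvPolynomial.X, MvPolynomial.monomial_mul, mul_one]
      rfl
    rw [e, map_sub, specialize_monomial_mul, specialize_monomial_mul]
    have h : Commute Q (P ^ s 0) := hPQ.symm.pow_right _
    simp [pow_succ', mul_assoc, ← mul_assoc Q (P ^ _), h.eq]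

theorem subLambda_mem (P Q : DiffOp K) : subLambda P ∈ leftIdealPair P Q :=
  Ideal.subset_span (by simp)

theorem subMu_mem (P Q : DiffOp K) : subMu Q ∈ leftIdealPair P Q :=
  Ideal.subset_span (by simp)

/-- Telescoping from `λ ≡ P` and `μ ≡ Q`. The ideal is only a left ideal, so each difference must
stand as the right factor; this is possible because `λ` and `μ` are central. -/
theorem C_monomial_sub_mem (P Q : DiffOp K) (s : Fin 2 →₀ ℕ) :
    C (MvPolynomial.monomial s 1) - extendHom K (P ^ s 0 * Q ^ s 1) ∈ leftIdealPair P Q := by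
  have hpow : ∀ (j : Fin 2) (T : DiffOp K), C (MvPolynomial.X j) - extendHom K T ∈
      leftIdealPair P Q → ∀ i, C (MvPolynomial.X j) ^ i - extendHom K T ^ i ∈
        leftIdealPair P Q := by
    intro j T hT i
    induction i with
    | zero => simp
    | succ i ih =>
      have hc := (commute_C_X j (C (MvPolynomial.X j) - extendHom K T)).pow_left i
      have e : C (MvPolynomial.X j) ^ (i + 1) - extendHom K T ^ (i + 1) =
          C (MvPolynomial.X j) ^ i * (C (MvPolynomial.X j) - extendHom K T) +
            extendHom K T * (C (MvPolynomial.X j) ^ i - extendHom K T ^ i) := by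
        rw [hc.eq, pow_succ', pow_succ', sub_mul, mul_sub]
        abel
      rw [e]
      exact add_mem (Ideal.mul_mem_left _ _ hT) (Ideal.mul_mem_left _ _ ih)
  have hP := hpow 0 P (by
    simpa [subLambda, extendHom_apply] using neg_mem (subLambda_mem P Q)) (s 0)
  have hQ := hpow 1 Q (by
    simpa [subMu, extendHom_apply] using neg_mem (subMu_mem P Q)) (s 1)
  have hc := (commute_C_X 1 (C (MvPolynomial.X 0) ^ s 0 - extendHom K P ^ s 0)).pow_left (s 1)
  have e : C (MvPolynomial.monomial s 1) - extendHom K (P ^ s 0 * Q ^ s 1) =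
      C (MvPolynomial.X 1) ^ s 1 * (C (MvPolynomial.X 0) ^ s 0 - extendHom K P ^ s 0) +
        extendHom K P ^ s 0 * (C (MvPolynomial.X 1) ^ s 1 - extendHom K Q ^ s 1) := by
    rw [hc.eq, MvPolynomial.monomial_fin_two, map_one, one_mul, sub_mul, mul_sub]
    simp only [map_mul, map_pow, sub_add_sub_cancel]
  rw [e]
  exact add_mem (Ideal.mul_mem_left _ _ hP) (Ideal.mul_mem_left _ _ hQ)

/-- Every operator is congruent to its specialization modulo the left ideal, so the kernel of the
specialization is contained in that ideal. -/
theorem sub_extend_specialize_mem (P Q : DiffOp K)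
    (A : DiffOp (MvPolynomial (Fin 2) K)) :
    A - extendHom K (specialize P Q A) ∈ leftIdealPair P Q := by
  induction A using diffOp_mvPolynomial_induction with
  | hadd A B hA hB =>
    rw [map_add, map_add, add_sub_add_comm]
    exact add_mem hA hB
  | hmon s T =>
    rw [specialize_monomial_mul, (commute_C_monomial s _).eq, map_mul, ← mul_sub]
    exact Ideal.mul_mem_left _ _ (C_monomial_sub_mem P Q s)

/-- The left ideal `(P - λ, Q - μ)` is the kernel of the specialization `λ ↦ P`, `μ ↦ Q`. -/
theorem mem_leftIdealPair_iff (P Q : DiffOp K) (hPQ : Commute P Q)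
    (A : DiffOp (MvPolynomial (Fin 2) K)) :
    A ∈ leftIdealPair P Q ↔ specialize P Q A = 0 := by
  constructor
  · intro h
    obtain ⟨X, Y, rfl⟩ := exists_of_mem_span_pair h
    rw [map_add, specialize_mul_subLambda, specialize_mul_subMu P Q hPQ, add_zero]
  · intro h
    simpa [h] using sub_extend_specialize_mem P Q A

theorem mem_elimIdeal_iff (P Q : DiffOp K) (hPQ : Commute P Q) (g : MvPolynomial (Fin 2) K) :
    g ∈ elimIdeal P Q ↔ evalAfter P Q 1 g = 0 := by
  rw [← specialize_C, ← mem_leftIdealPair_iff P Q hPQ]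
  exact Ideal.mem_comap

theorem evalAfter_constIncl (P Q : DiffOp K) (g : MvPolynomial (Fin 2) (constants K)) :
    evalAfter P Q 1 (constIncl K g) = evalPair P Q g := by
  induction g using MvPolynomial.induction_on' with
  | add f g hf hg => rw [map_add, map_add, hf, hg, evalPair_add]
  | monomial s c =>
    rw [constIncl, MvPolynomial.map_monomial, evalAfter_monomial, evalPair_monomial, one_mul]


/-! ### Filtration by the order of the value; primality of the elimination ideal -/

theorem deriv_coe_constants (c : constants K) : (c : K)′ = 0 := c.2

theorem evalPair_mul (P Q : DiffOp K) (hPQ : Commute P Q)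
    (f g : MvPolynomial (Fin 2) (constants K)) :
    evalPair P Q (f * g) = evalPair P Q f * evalPair P Q g := by
  have hone : evalPair P Q 1 = 1 := by
    simpa using evalPair_monomial P Q 0 1
  induction g using MvPolynomial.induction_on with
  | C c =>
    have hc := evalPair_C_mul P Q c 1
    rw [mul_one, hone, mul_one] at hc
    rw [mul_comm, evalPair_C_mul, hc]
    exact commute_C_of_deriv_eq_zero (deriv_coe_constants c) _
  | add p q hp hq => rw [mul_add, evalPair_add, hp, hq, evalPair_add, mul_add]
  | mul_X p i hp =>
    rw [← mul_assoc, evalPair_mul_X P Q hPQ, hp, evalPair_mul_X P Q hPQ, mul_assoc]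

theorem evalPair_X_zero (P Q : DiffOp K) : evalPair P Q (MvPolynomial.X 0) = P := by
  rw [MvPolynomial.X, evalPair_monomial]
  simp

theorem commute_evalPair (P Q : DiffOp K) (hPQ : Commute P Q)
    (f : MvPolynomial (Fin 2) (constants K)) : Commute P (evalPair P Q f) := by
  have := evalPair_mul P Q hPQ (MvPolynomial.X 0) f
  rw [mul_comm, evalPair_mul P Q hPQ, evalPair_X_zero] at this
  exact this.symm

/-- Leading coefficients of operators of the same order in the centralizer of an operator of
positive order have the same logarithmic derivative. -/
theorem wronskian_coeff_eq_zero [CharZero K] {P A B : DiffOp K} (hP : 0 < P.order)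
    (hA : Commute P A) (hB : Commute P B) {s : ℕ} (hAs : A.OrderLT (s + 1))
    (hBs : B.OrderLT (s + 1)) :
    (A.coeff s)′ * B.coeff s = A.coeff s * (B.coeff s)′ := by
  obtain ⟨n, hn⟩ : ∃ n, P.order = n + 1 := ⟨P.order - 1, by omega⟩
  have hPlt := P.orderLT_order_succ
  have hp : P.leadingCoeff ≠ 0 := leadingCoeff_ne_zero (ne_zero_of_order_pos hP)
  unfold leadingCoeff at hp
  rw [hn] at hPlt hp
  -- Passing from `T` to `T * P`, which still commutes with `P`, makes the order positive even for
  -- `s = 0`, as the comparison of second coefficients requires.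
  have key : ∀ T : DiffOp K, Commute P T → T.OrderLT (s + 1) →
      (n + 1 : ℕ) * P.coeff (n + 1) * (T.coeff s * P.coeff (n + 1))′ =
        (s + n + 1 : ℕ) * (T.coeff s * P.coeff (n + 1)) * (P.coeff (n + 1))′ := by
    intro T hT hTs
    have h := leadingCoeff_relation_of_commute (a := n) (b := s + n) hPlt
      ((hTs.mul hPlt).mono (by omega) : (T * P).OrderLT (s + n + 2))
      (hT.mul_right (Commute.refl P))
    rwa [show s + n + 1 = s + (n + 1) by omega, coeff_mul_top hTs hPlt] at h
  have h1 := key A hA hAs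
  have h2 := key B hB hBs
  rw [Derivation.leibniz, smul_eq_mul, smul_eq_mul] at h1 h2
  have hn0 : ((n + 1 : ℕ) : K) ≠ 0 := Nat.cast_ne_zero.mpr (Nat.succ_ne_zero n)
  have : ((n + 1 : ℕ) : K) * P.coeff (n + 1) ^ 2 *
      ((A.coeff s)′ * B.coeff s - A.coeff s * (B.coeff s)′) = 0 := by
    linear_combination B.coeff s * h1 - A.coeff s * h2
  rcases mul_eq_zero.mp this with h | h
  · exact absurd h (mul_ne_zero hn0 (pow_ne_zero 2 hp))
  · exact sub_eq_zero.mp h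

/-- The `K`-span of the polynomials `g ∈ C[λ, μ]` for which `g(P, Q)` has order less than `N`. -/
def orderSpan (P Q : DiffOp K) (N : ℕ) : Submodule K (MvPolynomial (Fin 2) K) :=
  Submodule.span K (constIncl K '' {g | (evalPair P Q g).OrderLT N})

theorem constIncl_mem_orderSpan {P Q : DiffOp K} {N : ℕ}
    {g : MvPolynomial (Fin 2) (constants K)} (hg : (evalPair P Q g).OrderLT N) :
    constIncl K g ∈ orderSpan P Q N :=
  Submodule.subset_span ⟨g, hg, rfl⟩

theorem orderSpan_mono (P Q : DiffOp K) {M N : ℕ} (h : M ≤ N) :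
    orderSpan P Q M ≤ orderSpan P Q N :=
  Submodule.span_mono (Set.image_mono fun _ hg => OrderLT.mono hg h)

theorem orderLT_evalAfter_of_mem_orderSpan {P Q : DiffOp K} {N : ℕ}
    {g : MvPolynomial (Fin 2) K} (hg : g ∈ orderSpan P Q N) :
    (evalAfter P Q 1 g).OrderLT N := by
  induction hg using Submodule.span_induction with
  | mem x hx =>
    obtain ⟨f, hf, rfl⟩ := hx
    rw [evalAfter_constIncl]
    exact hf
  | zero => rw [map_zero]; exact fun k _ => DiffOp.coeff_zero k
  | add x y _ _ hx hy => rw [map_add]; exact hx.add hy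
  | smul a x _ hx => rw [map_smul, smul_eq_C_mul]; exact hx.C_mul a

theorem constIncl_C_mul (c : constants K) (g : MvPolynomial (Fin 2) (constants K)) :
    constIncl K (MvPolynomial.C c * g) = (c : K) • constIncl K g := by
  rw [map_mul, MvPolynomial.smul_eq_C_mul, constIncl, MvPolynomial.map_C]
  rfl

/-- In each order, one constant polynomial suffices modulo lower order: leading coefficients of two
values have constant ratio, so subtracting a constant multiple lowers the order without leaving
`C[λ, μ]`. -/
theorem exists_eq_smul_add_of_mem_orderSpan [CharZero K] {P Q : DiffOp K} (hPQ : Commute P Q)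
    (hP : 0 < P.order) {N : ℕ} {g : MvPolynomial (Fin 2) K} (hg : g ∈ orderSpan P Q (N + 1)) :
    ∃ (a : K) (f : MvPolynomial (Fin 2) (constants K)) (r : MvPolynomial (Fin 2) K),
      (evalPair P Q f).OrderLT (N + 1) ∧ r ∈ orderSpan P Q N ∧ g = a • constIncl K f + r := by
  induction hg using Submodule.span_induction with
  | mem x hx =>
    obtain ⟨f, hf, rfl⟩ := hx
    exact ⟨1, f, 0, hf, zero_mem _, by simp⟩
  | zero =>
    refine ⟨0, 0, 0, ?_, zero_mem _, by simp⟩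
    rw [← evalAfter_constIncl, map_zero, map_zero]
    exact fun k _ => DiffOp.coeff_zero k
  | smul a x _ hx =>
    obtain ⟨b, f, r, hf, hr, rfl⟩ := hx
    exact ⟨a * b, f, a • r, hf, Submodule.smul_mem _ a hr, by rw [smul_add, smul_smul]⟩
  | add x y _ _ hx hy =>
    obtain ⟨a, f, r, hf, hr, rfl⟩ := hx
    obtain ⟨b, g, t, hg, ht, rfl⟩ := hy
    by_cases h0 : (evalPair P Q f).coeff N = 0
    · exact ⟨b, g, a • constIncl K f + r + t, hg, add_mem (add_mem (Submodule.smul_mem _ a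
        (constIncl_mem_orderSpan (hf.of_succ h0))) hr) ht, by abel⟩
    · have hw := wronskian_coeff_eq_zero hP (commute_evalPair P Q hPQ g)
        (commute_evalPair P Q hPQ f) hg hf
      -- The quotient is a constant because the Wronskian `hw` is the numerator of its derivative.
      let c : constants K := ⟨(evalPair P Q g).coeff N / (evalPair P Q f).coeff N, by
        change (_)′ = 0
        rw [Derivation.leibniz_div]
        simp only [smul_eq_mul]
        linear_combination ((evalPair P Q f).coeff N)⁻¹ ^ 2 * hw⟩
      have hc : (c : K) * (evalPair P Q f).coeff N = (evalPair P Q g).coeff N :=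
        div_mul_cancel₀ _ h0
      have hmem : constIncl K g - (c : K) • constIncl K f ∈ orderSpan P Q N := by
        rw [← constIncl_C_mul, ← map_sub]
        refine constIncl_mem_orderSpan (OrderLT.of_succ ?_ ?_)
        all_goals rw [← evalAfter_constIncl, map_sub, map_sub, constIncl_C_mul, map_smul,
          evalAfter_constIncl, evalAfter_constIncl, smul_eq_C_mul]
        · exact hg.sub (hf.C_mul _)
        · rw [coeff_sub, coeff_C_mul, hc, sub_self]
      refine ⟨a + b * c, f, r + t + b • (constIncl K g - (c : K) • constIncl K f), hf,
        add_mem (add_mem hr ht) (Submodule.smul_mem _ b hmem), ?_⟩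
      rw [add_smul, mul_smul, smul_sub]
      abel

theorem exists_mem_orderSpan (P Q : DiffOp K) (g : MvPolynomial (Fin 2) K) :
    ∃ N, g ∈ orderSpan P Q N := by
  induction g using MvPolynomial.induction_on' with
  | monomial s a =>
    refine ⟨(evalPair P Q (MvPolynomial.monomial s 1)).order + 1, ?_⟩
    have : MvPolynomial.monomial s a = a • constIncl K (MvPolynomial.monomial s 1) := by
      simp [constIncl, MvPolynomial.smul_monomial]
    rw [this]
    exact Submodule.smul_mem _ a (constIncl_mem_orderSpan (orderLT_order_succ _))
  | add f g hf hg =>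
    obtain ⟨M, hM⟩ := hf
    obtain ⟨N, hN⟩ := hg
    exact ⟨max M N, add_mem (orderSpan_mono P Q (le_max_left M N) hM)
      (orderSpan_mono P Q (le_max_right M N) hN)⟩

/-- For the converse, descend on the bound. In `g = a f + r` with `r` of lower order, vanishing of
the top coefficient forces `a = 0` or a lower order for the value of `f`; either way `g` lies one
step lower. -/
theorem mem_orderSpan_iff [CharZero K] {P Q : DiffOp K} (hPQ : Commute P Q)
    (hP : 0 < P.order) {N : ℕ} {g : MvPolynomial (Fin 2) K} :
    g ∈ orderSpan P Q N ↔ (evalAfter P Q 1 g).OrderLT N := by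
  refine ⟨orderLT_evalAfter_of_mem_orderSpan, fun h => ?_⟩
  obtain ⟨M, hM⟩ := exists_mem_orderSpan P Q g
  suffices ∀ j, g ∈ orderSpan P Q (N + j) → g ∈ orderSpan P Q N from
    this M (orderSpan_mono P Q (by omega) hM)
  intro j
  induction j with
  | zero => exact id
  | succ j ih =>
    intro hj
    obtain ⟨a, f, r, hf, hr, rfl⟩ := exists_eq_smul_add_of_mem_orderSpan hPQ hP hj
    refine ih (add_mem ?_ hr)
    have h1 := h (N + j) (by omega)
    rw [map_add, coeff_add, orderLT_evalAfter_of_mem_orderSpan hr (N + j) le_rfl, add_zero,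
      map_smul, smul_eq_C_mul, coeff_C_mul, evalAfter_constIncl] at h1
    rcases mul_eq_zero.mp h1 with h1 | h1
    · rw [h1, zero_smul]; exact zero_mem _
    · exact Submodule.smul_mem _ a (constIncl_mem_orderSpan (hf.of_succ h1))

/-- Although specialization is not multiplicative on `K[λ, μ]`, its leading coefficients are. -/
theorem coeff_evalAfter_mul [CharZero K] {P Q : DiffOp K} (hPQ : Commute P Q)
    (hP : 0 < P.order) {a b : ℕ} {f g : MvPolynomial (Fin 2) K}
    (hf : (evalAfter P Q 1 f).OrderLT (a + 1)) (hg : (evalAfter P Q 1 g).OrderLT (b + 1)) :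
    (evalAfter P Q 1 (f * g)).coeff (a + b) =
      (evalAfter P Q 1 f).coeff a * (evalAfter P Q 1 g).coeff b := by
  -- Both sides are bilinear over `K`, so it is enough to treat constant polynomials, on which
  -- evaluation is multiplicative.
  rw [← mem_orderSpan_iff hPQ hP] at hf hg
  induction hf using Submodule.span_induction with
  | zero => simp [DiffOp.coeff_zero]
  | add x y _ _ hx hy => simp only [add_mul, map_add, coeff_add, hx, hy]
  | smul c x _ hx =>
    rw [smul_mul_assoc, map_smul, map_smul, smul_eq_C_mul, smul_eq_C_mul, coeff_C_mul,
      coeff_C_mul, hx, mul_assoc]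
  | mem x hx =>
    obtain ⟨f, hf, rfl⟩ := hx
    induction hg using Submodule.span_induction with
    | zero => simp [DiffOp.coeff_zero]
    | add x y _ _ hx hy => simp only [mul_add, map_add, coeff_add, hx, hy]
    | smul c x _ hx =>
      rw [mul_smul_comm, map_smul, map_smul, smul_eq_C_mul, smul_eq_C_mul, coeff_C_mul,
        coeff_C_mul, hx, mul_left_comm]
    | mem x hx =>
      obtain ⟨g, hg, rfl⟩ := hx
      rw [← map_mul, evalAfter_constIncl, evalAfter_constIncl, evalAfter_constIncl,
        evalPair_mul P Q hPQ, coeff_mul_top hf hg]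

theorem evalAfter_one (P Q : DiffOp K) : evalAfter P Q 1 1 = 1 := by
  simpa using evalAfter_monomial P Q 1 0 1

instance instNontrivialDiffOp {R : Type*} [CommRing R] [Nontrivial R] : Nontrivial (DiffOp R) :=
  inferInstanceAs (Nontrivial (Polynomial R))

/-- If neither value vanishes, the value of the product has the product of two nonzero leading
coefficients as a coefficient. -/
theorem isPrime_elimIdeal [CharZero K] {P Q : DiffOp K} (hPQ : Commute P Q)
    (hP : 0 < P.order) : (elimIdeal P Q).IsPrime where
  ne_top' := by
    rw [Ideal.ne_top_iff_one, mem_elimIdeal_iff P Q hPQ, evalAfter_one]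
    exact one_ne_zero
  mem_or_mem' := by
    intro f g hfg
    by_contra! h
    rw [mem_elimIdeal_iff P Q hPQ, mem_elimIdeal_iff P Q hPQ] at h
    rw [mem_elimIdeal_iff P Q hPQ] at hfg
    have e := coeff_evalAfter_mul hPQ hP (orderLT_order_succ (evalAfter P Q 1 f))
      (orderLT_order_succ (evalAfter P Q 1 g))
    rw [hfg, DiffOp.coeff_zero] at e
    exact mul_ne_zero (leadingCoeff_ne_zero h.1) (leadingCoeff_ne_zero h.2) e.symm

theorem elimIdealConst_eq_bcIdeal (P Q : DiffOp K) (hPQ : Commute P Q) :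
    elimIdealConst P Q = bcIdeal P Q hPQ := by
  ext g
  change constIncl K g ∈ elimIdeal P Q ↔ evalPair P Q g = 0
  rw [mem_elimIdeal_iff P Q hPQ, evalAfter_constIncl]

/-- The elimination ideal in `K[λ, μ]` is generated by the Burchnall-Chaundy ideal. -/
theorem elimIdeal_eq_map_bcIdeal [CharZero K] {P Q : DiffOp K} (hPQ : Commute P Q)
    (hP : 0 < P.order) : elimIdeal P Q = (bcIdeal P Q hPQ).map (constIncl K) := by
  refine le_antisymm (fun g hg => ?_) ?_
  · rw [mem_elimIdeal_iff P Q hPQ] at hg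
    -- Order less than `0` means being zero, so the generators of this span are the elements of
    -- `BC(P, Q)`.
    have hg' : g ∈ orderSpan P Q 0 := by
      rw [mem_orderSpan_iff hPQ hP, hg]
      exact fun k _ => DiffOp.coeff_zero k
    induction hg' using Submodule.span_induction with
    | mem x hx =>
      obtain ⟨f, hf, rfl⟩ := hx
      exact Ideal.mem_map_of_mem _ hf.eq_zero
    | zero => exact zero_mem _
    | add x y hx hy ihx ihy =>
      exact add_mem (ihx (orderLT_evalAfter_of_mem_orderSpan hx).eq_zero)
        (ihy (orderLT_evalAfter_of_mem_orderSpan hy).eq_zero)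
    | smul a x hx ihx =>
      rw [MvPolynomial.smul_eq_C_mul]
      exact Ideal.mul_mem_left _ _ (ihx (orderLT_evalAfter_of_mem_orderSpan hx).eq_zero)
  · rw [Ideal.map_le_iff_le_comap]
    exact (elimIdealConst_eq_bcIdeal P Q hPQ).ge

end

end

/-! ### Height-one primes in two variables -/

noncomputable section

/-- A nonzero prime ideal of `F[λ, μ]` over an algebraically closed field that contains no
`λ - c` is generated by an irreducible polynomial. -/
theorem MvPolynomial.exists_eq_span_irreducible {F : Type*} [Field F] [IsAlgClosed F]
    (I : Ideal (MvPolynomial (Fin 2) F)) [hI : I.IsPrime] (hbot : I ≠ ⊥)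
    (hX : ∀ c : F, MvPolynomial.X 0 - MvPolynomial.C c ∉ I) :
    ∃ f, Irreducible f ∧ I = Ideal.span {f} := by
  have hdim : ringKrullDim (MvPolynomial (Fin 2) F) = 2 := by
    rw [MvPolynomial.ringKrullDim_of_isNoetherianRing, ringKrullDim_eq_zero_of_field]
    simp
  have hfin : FiniteRingKrullDim (MvPolynomial (Fin 2) F) := by
    rw [finiteRingKrullDim_iff_ne_bot_and_top, hdim]
    exact ⟨by decide, by decide⟩
  -- Nullstellensatz: the residue field at a maximal ideal is finite over `F`, hence equal to `F`,
  -- so `λ` is congruent to some `c`.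
  have hmax : ¬ I.IsMaximal := by
    intro hm
    let _ := Ideal.Quotient.field I
    have := finite_of_finite_type_of_isJacobsonRing F (MvPolynomial (Fin 2) F ⧸ I)
    obtain ⟨c, hc⟩ := IsAlgClosed.algebraMap_bijective_of_isIntegral (k := F) |>.surjective
      (Ideal.Quotient.mk I (MvPolynomial.X 0))
    exact hX c (Ideal.Quotient.eq.mp hc.symm)
  have hle : (I.height : WithBot ℕ∞) ≤ 2 := hdim ▸ I.height_le_ringKrullDim_of_isPrime
  have hne : (I.height : WithBot ℕ∞) ≠ 2 := fun h =>
    hmax (Ideal.isMaximal_of_height_eq_ringKrullDim (h.trans hdim.symm))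
  have h0 : I.height ≠ 0 := fun h => hbot (Ideal.height_eq_zero_iff_eq_bot.mp h)
  have h1 : I.height = 1 := by
    have hle' : I.height ≤ 2 := WithBot.coe_le_coe.mp hle
    have hne' : I.height ≠ 2 := fun h => hne (congrArg _ h)
    have hlt := lt_of_le_of_ne hle' hne'
    exact le_antisymm (ENat.lt_add_one_iff (by decide) |>.mp hlt) (Order.one_le_iff_ne_zero.mpr h0)
  obtain ⟨f, hf⟩ := (UniqueFactorizationMonoid.isPrincipal_of_height_eq_one h1).principal
  have hf0 : f ≠ 0 := by
    rintro rfl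
    exact hbot (by rw [hf]; simp)
  refine ⟨f, ?_, hf⟩
  have : (Ideal.span {f}).IsPrime := by rwa [hf] at hI
  exact ((Ideal.span_singleton_prime hf0).mp this).irreducible

end

/-! ### The resultant of `P - λ` and `Q - μ` -/

noncomputable section

open DiffOp

section

variable {K : Type*} [Field K] [Differential K]

theorem order_subLambda (P : DiffOp K) : (subLambda P).order = P.order := by
  have : toPoly (subLambda P) =
      (toPoly P).map MvPolynomial.C - Polynomial.C (MvPolynomial.X 0) := map_sub toPoly _ _
  rw [order, this, Polynomial.natDegree_sub_C,
    Polynomial.natDegree_map_eq_of_injective (MvPolynomial.C_injective _ _)]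
  rfl

theorem order_subMu (Q : DiffOp K) : (subMu Q).order = Q.order := by
  have : toPoly (subMu Q) =
      (toPoly Q).map MvPolynomial.C - Polynomial.C (MvPolynomial.X 1) := map_sub toPoly _ _
  rw [order, this, Polynomial.natDegree_sub_C,
    Polynomial.natDegree_map_eq_of_injective (MvPolynomial.C_injective _ _)]
  rfl

theorem isUnit_leadingCoeff_subLambda {P : DiffOp K} (hP : 0 < P.order) :
    IsUnit (subLambda P).leadingCoeff := by
  have : (subLambda P).leadingCoeff = MvPolynomial.C P.leadingCoeff := by
    unfold leadingCoeff
    obtain ⟨n, hn⟩ : ∃ n, P.order = n + 1 := ⟨P.order - 1, by omega⟩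
    rw [order_subLambda, subLambda, coeff_sub, ← extendHom_apply, coeff_extendHom, hn,
      coeff_C_succ, sub_zero]
  rw [this]
  exact (leadingCoeff_ne_zero (ne_zero_of_order_pos hP)).isUnit.map _

theorem commute_subLambda_subMu {P Q : DiffOp K} (hPQ : Commute P Q) :
    Commute (subLambda P) (subMu Q) := by
  have h : Commute (extendCoeffs P) (extendCoeffs Q) := hPQ.map (extendHom K)
  exact (h.sub_left (commute_C_X 0 _)).sub_right ((commute_C_X 1 _).symm)

theorem coeff_d_pow_mul_subLambda (P : DiffOp K) (k i : ℕ) :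
    (d ^ k * subLambda P).coeff i =
      MvPolynomial.C ((d ^ k * P).coeff i) - MvPolynomial.X 0 * if k = i then 1 else 0 := by
  rw [subLambda, mul_sub, coeff_sub, ← (commute_C_X 0 (d ^ k)).eq, coeff_C_mul, coeff_d_pow,
    ← coeff_extendHom, map_mul, map_pow, extendHom_d, extendHom_apply]

theorem coeff_d_pow_mul_subMu (Q : DiffOp K) (k i : ℕ) :
    (d ^ k * subMu Q).coeff i =
      MvPolynomial.C ((d ^ k * Q).coeff i) - MvPolynomial.X 1 * if k = i then 1 else 0 := by
  rw [subMu, mul_sub, coeff_sub, ← (commute_C_X 1 (d ^ k)).eq, coeff_C_mul, coeff_d_pow,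
    ← coeff_extendHom, map_mul, map_pow, extendHom_d, extendHom_apply]

/-- The substitution `λ ↦ 0`. -/
def restrictMu (F : Type*) [CommRing F] : MvPolynomial (Fin 2) F →+* Polynomial F :=
  MvPolynomial.eval₂Hom Polynomial.C ![0, Polynomial.X]

theorem restrictMu_C {F : Type*} [CommRing F] (a : F) :
    restrictMu F (MvPolynomial.C a) = Polynomial.C a := by
  simp [restrictMu]

theorem restrictMu_constIncl (g : MvPolynomial (Fin 2) (constants K)) :
    restrictMu K (constIncl K g) = (restrictMu (constants K) g).map (constants K).subtype := by
  have : (restrictMu K).comp (constIncl K) =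
      (Polynomial.mapRingHom (constants K).subtype).comp (restrictMu (constants K)) := by
    refine MvPolynomial.ringHom_ext (fun c => ?_) fun i => ?_
    · simp [restrictMu, constIncl]
    · fin_cases i <;> simp [restrictMu, constIncl]
  exact congrArg (fun φ => φ g) this

/-- The pure power of `μ` of highest degree in the resultant has coefficient `± aₙᵐ`. -/
theorem coeff_restrictMu_spectralRes (P Q : DiffOp K) :
    (restrictMu K (spectralRes P Q)).coeff P.order =
      P.leadingCoeff ^ Q.order * (-1) ^ P.order := by
  rw [← order_subLambda, ← order_subMu]
  let top : Matrix (Fin ((subMu Q).order + (subLambda P).order))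
      (Fin ((subMu Q).order + (subLambda P).order)) K := Matrix.of fun i j =>
    Fin.addCases (motive := fun _ => K)
      (fun k : Fin (subMu Q).order => (d ^ ((subMu Q).order - 1 - (k : ℕ)) * P).coeff
        ((subMu Q).order + (subLambda P).order - 1 - j))
      (fun k : Fin (subLambda P).order =>
        -(if (subLambda P).order - 1 - (k : ℕ) = (subMu Q).order + (subLambda P).order - 1 - j then 1 else 0)) i
  let low : Matrix (Fin ((subMu Q).order + (subLambda P).order))
      (Fin ((subMu Q).order + (subLambda P).order)) K := Matrix.of fun i j =>
    Fin.addCases (motive := fun _ => K) (fun _ : Fin (subMu Q).order => 0)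
      (fun k : Fin (subLambda P).order => (d ^ ((subLambda P).order - 1 - (k : ℕ)) * Q).coeff
        ((subMu Q).order + (subLambda P).order - 1 - j)) i
  -- At `λ = 0` the rows from `P` are free of `μ`. Multiplying these `m` rows by `μ` makes the whole
  -- matrix `μ • top + low`, so the coefficient of `μⁿ⁺ᵐ` in `μᵐ h` is `det top`.
  let scale : Fin ((subMu Q).order + (subLambda P).order) → Polynomial K :=
    Fin.addCases (motive := fun _ => Polynomial K) (fun _ : Fin (subMu Q).order => Polynomial.X)
      (fun _ : Fin (subLambda P).order => 1)
  have hmat : Matrix.diagonal scale * (restrictMu K).mapMatrix (sylvester (subLambda P) (subMu Q))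
      = (Polynomial.X : Polynomial K) • top.map Polynomial.C + low.map Polynomial.C := by
    ext1 i j
    rw [Matrix.diagonal_mul, RingHom.mapMatrix_apply, Matrix.map_apply, sylvester_apply]
    simp only [Matrix.add_apply, Matrix.smul_apply, Matrix.map_apply, top, low, Matrix.of_apply,
      scale, sylvesterRow]
    refine Fin.addCases (fun k => ?_) (fun k => ?_) i
    · simp only [Fin.addCases_left]
      rw [coeff_d_pow_mul_subLambda P, map_sub, map_mul, restrictMu_C]
      simp [restrictMu]
    · simp only [Fin.addCases_right]
      rw [coeff_d_pow_mul_subMu, map_sub, map_mul, restrictMu_C]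
      simp only [restrictMu]
      split_ifs <;> (simp; try ring)
  have hscale : (Matrix.diagonal scale).det = Polynomial.X ^ (subMu Q).order := by
    rw [Matrix.det_diagonal, Fin.prod_univ_add]
    simp [scale]
  have htop : top.det = P.leadingCoeff ^ (subMu Q).order * (-1) ^ (subLambda P).order := by
    have hPlt : P.OrderLT ((subLambda P).order + 1) := by
      rw [order_subLambda]
      exact P.orderLT_order_succ
    -- Rows are listed by decreasing order of the operators `∂ᵏ P` and of the terms `-∂ᵏ` from `-μ
    -- ∂ᵏ`; the leading term of each falls on the diagonal.
    have htri : top.IsUpperTriangular := by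
      intro i j hij
      change j < i at hij
      revert hij
      refine Fin.addCases (fun k => ?_) (fun k => ?_) i <;> intro hij <;>
        simp only [top, Matrix.of_apply, Fin.addCases_left, Fin.addCases_right]
      · have : (j : ℕ) < k := hij
        exact hPlt.d_pow_mul _ _ (by omega)
      · have : (j : ℕ) < (subMu Q).order + k := hij
        rw [if_neg (by omega), neg_zero]
    rw [Matrix.det_of_isUpperTriangular htri, Fin.prod_univ_add]
    have h1 : ∀ k : Fin (subMu Q).order,
        top (Fin.castAdd (subLambda P).order k) (Fin.castAdd (subLambda P).order k) = P.leadingCoeff := by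
      intro k
      simp only [top, Matrix.of_apply, Fin.addCases_left, Fin.val_castAdd]
      rw [show (subMu Q).order + (subLambda P).order - 1 - (k : ℕ) =
        (subLambda P).order + ((subMu Q).order - 1 - k) by omega, coeff_d_pow_mul_top hPlt,
        order_subLambda]
      rfl
    have h2 : ∀ k : Fin (subLambda P).order,
        top (Fin.natAdd (subMu Q).order k) (Fin.natAdd (subMu Q).order k) = -1 := by
      intro k
      simp only [top, Matrix.of_apply, Fin.addCases_right, Fin.val_natAdd]
      rw [if_pos (by omega)]
    simp [h1, h2]
  have hdet := Polynomial.coeff_det_X_add_C_card top low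
  rw [← hmat, Matrix.det_mul, hscale, ← RingHom.map_det, Fintype.card_fin,
    Polynomial.coeff_X_pow_mul', if_pos (Nat.le_add_right _ _), Nat.add_sub_cancel_left,
    htop] at hdet
  exact hdet


theorem spectralRes_mem_elimIdeal (P Q : DiffOp K) (hP : 0 < P.order) :
    spectralRes P Q ∈ elimIdeal P Q :=
  C_dRes_mem _ _ (by rwa [order_subLambda])

theorem restrictMu_spectralRes_coeff_ne_zero (P Q : DiffOp K) (hP : 0 < P.order) :
    (restrictMu K (spectralRes P Q)).coeff P.order ≠ 0 := by
  rw [coeff_restrictMu_spectralRes]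
  exact mul_ne_zero (pow_ne_zero _ (leadingCoeff_ne_zero (ne_zero_of_order_pos hP)))
    (pow_ne_zero _ (neg_ne_zero.mpr one_ne_zero))

theorem deriv_constIncl (g : MvPolynomial (Fin 2) (constants K)) : (constIncl K g)′ = 0 := by
  ext s
  rw [coeff_deriv_mvPolynomial, constIncl, MvPolynomial.coeff_map, MvPolynomial.coeff_zero]
  exact (g.coeff s).2

theorem constIncl_injective : Function.Injective (constIncl K) :=
  MvPolynomial.map_injective _ (constants K).subtype_injective

theorem isPrime_bcIdeal [CharZero K] {P Q : DiffOp K} (hPQ : Commute P Q) (hP : 0 < P.order) :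
    (bcIdeal P Q hPQ).IsPrime := by
  have := isPrime_elimIdeal hPQ hP
  rw [← elimIdealConst_eq_bcIdeal]
  exact Ideal.comap_isPrime _ _

/-- The Burchnall-Chaundy ideal is generated by an irreducible polynomial. -/
theorem exists_bcIdeal_eq_span [CharZero K] [IsAlgClosed (constants K)] {P Q : DiffOp K}
    (hPQ : Commute P Q) (hP : 0 < P.order) :
    ∃ f, Irreducible f ∧ bcIdeal P Q hPQ = Ideal.span {f} := by
  have := isPrime_bcIdeal hPQ hP
  refine MvPolynomial.exists_eq_span_irreducible _ (fun h => ?_) fun c hc => ?_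
  -- If `BC(P, Q)` were zero, so would be the elimination ideal it generates, which contains the
  -- nonzero resultant.
  · have hmem := spectralRes_mem_elimIdeal P Q hP
    rw [elimIdeal_eq_map_bcIdeal hPQ hP, h, Ideal.map_bot, Ideal.mem_bot] at hmem
    have := restrictMu_spectralRes_coeff_ne_zero P Q hP
    simp [hmem] at this
  · have h0 : evalPair P Q (MvPolynomial.X 0 - MvPolynomial.C c) = 0 := hc
    have h1 := evalPair_add P Q (MvPolynomial.X 0 - MvPolynomial.C c) (MvPolynomial.C c)
    rw [sub_add_cancel, h0, zero_add, evalPair_X_zero, ← MvPolynomial.monomial_zero',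
      evalPair_monomial] at h1
    simp only [Finsupp.coe_zero, Pi.zero_apply, pow_zero, mul_one] at h1
    rw [h1] at hP
    exact hP.ne' (Polynomial.natDegree_C (R := K) _)

theorem elimIdeal_eq_span [CharZero K] {P Q : DiffOp K}
    (hPQ : Commute P Q) (hP : 0 < P.order) {f : MvPolynomial (Fin 2) (constants K)}
    (hf : bcIdeal P Q hPQ = Ideal.span {f}) : elimIdeal P Q = Ideal.span {constIncl K f} := by
  rw [elimIdeal_eq_map_bcIdeal hPQ hP, hf, Ideal.map_span, Set.image_singleton]

/-- The resultant is a power of the generator of the Burchnall-Chaundy ideal, up to a factor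
in `K`. -/
theorem exists_spectralRes_eq_pow [CharZero K] {P Q : DiffOp K}
    (hPQ : Commute P Q) (hP : 0 < P.order) {f : MvPolynomial (Fin 2) (constants K)}
    (hf0 : f ≠ 0) (hf : bcIdeal P Q hPQ = Ideal.span {f}) :
    ∃ (a : K) (r : ℕ), a ≠ 0 ∧ r ≠ 0 ∧
      spectralRes P Q = MvPolynomial.C a * constIncl K (f ^ r) := by
  have hspan := elimIdeal_eq_span hPQ hP hf
  have hprime : Prime (constIncl K f) := by
    have := isPrime_elimIdeal hPQ hP
    rw [hspan] at this
    exact (Ideal.span_singleton_prime ((map_ne_zero_iff _ constIncl_injective).mpr hf0)).mp this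
  have hdvd : spectralRes P Q ∣ constIncl K f ^ _ :=
    dRes_dvd_pow (commute_subLambda_subMu hPQ) (isUnit_leadingCoeff_subLambda hP)
      (by rwa [order_subLambda]) (deriv_constIncl f)
      (show constIncl K f ∈ elimIdeal P Q from hspan ▸ Ideal.mem_span_singleton_self _)
  obtain ⟨r, _, u, hu⟩ := (dvd_prime_pow hprime _).mp hdvd
  obtain ⟨a, ha, hau⟩ := MvPolynomial.isUnit_iff_eq_C_of_isReduced.mp (u⁻¹).isUnit
  have e : spectralRes P Q = MvPolynomial.C a * constIncl K (f ^ r) := by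
    rw [map_pow, ← hu, ← hau, mul_comm, mul_assoc, Units.mul_inv, mul_one]
  refine ⟨a, r, ha.ne_zero, ?_, e⟩
  -- With `r = 0` the resultant would be a unit in a proper ideal.
  rintro rfl
  have hmem := spectralRes_mem_elimIdeal P Q hP
  rw [e, pow_zero, map_one, mul_one] at hmem
  exact (isPrime_elimIdeal hPQ hP).ne_top (Ideal.eq_top_of_isUnit_mem _ hmem (ha.map _))

/-- Two constant polynomials proportional over `K` are associated. -/
theorem associated_of_C_mul_constIncl_eq {a b : K} {f g : MvPolynomial (Fin 2) (constants K)}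
    (ha : a ≠ 0) (hb : b ≠ 0) (hg : g ≠ 0)
    (h : MvPolynomial.C a * constIncl K f = MvPolynomial.C b * constIncl K g) :
    Associated f g := by
  have hc : ∀ s, a * ((f.coeff s : constants K) : K) = b * ((g.coeff s : constants K) : K) :=
    fun s => by
    simpa [constIncl, MvPolynomial.coeff_map] using congrArg (MvPolynomial.coeff s) h
  -- A single nonzero coefficient fixes the ratio of `f` to `g` as a quotient of constants, although
  -- `a` and `b` need not be constant.
  obtain ⟨s, hs⟩ := MvPolynomial.ne_zero_iff.mp hg
  have hs' : ((g.coeff s : constants K) : K) ≠ 0 := by exact_mod_cast hs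
  have hf' : ((f.coeff s : constants K) : K) ≠ 0 := fun h0 => by
    have := hc s
    rw [h0, mul_zero] at this
    exact mul_ne_zero hb hs' this.symm
  have hfs : f.coeff s ≠ 0 := by exact_mod_cast hf'
  refine associated_of_dvd_dvd ⟨MvPolynomial.C (g.coeff s / f.coeff s), ?_⟩
    ⟨MvPolynomial.C (f.coeff s / g.coeff s), ?_⟩
  · ext t
    rw [mul_comm, MvPolynomial.coeff_C_mul]
    push_cast
    field_simp
    refine mul_left_cancel₀ (mul_ne_zero ha hb) ?_
    linear_combination a * ((f.coeff t : constants K) : K) * hc s -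
      a * ((f.coeff s : constants K) : K) * hc t
  · ext t
    rw [mul_comm, MvPolynomial.coeff_C_mul]
    push_cast
    field_simp
    refine mul_left_cancel₀ (mul_ne_zero ha hb) ?_
    linear_combination b * ((g.coeff s : constants K) : K) * hc t -
      b * ((g.coeff t : constants K) : K) * hc s

/-- In `h = a pʳ`, comparing coefficients of `μⁿ` at `λ = 0` gives `a b = ± aₙᵐ` with `b` a nonzero
constant, so `± pʳ / b` serves as `h₀`. -/
theorem exists_spectralRes_eq_leadingCoeff_pow_mul [CharZero K] [IsAlgClosed (constants K)]
    {P Q : DiffOp K} (hPQ : Commute P Q) (hP : 0 < P.order) :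
    ∃ h₀ : MvPolynomial (Fin 2) (constants K), h₀ ≠ 0 ∧
      spectralRes P Q = MvPolynomial.C (P.leadingCoeff ^ Q.order) * constIncl K h₀ := by
  obtain ⟨f, hirr, hf⟩ := exists_bcIdeal_eq_span hPQ hP
  obtain ⟨a, r, -, -, e⟩ := exists_spectralRes_eq_pow hPQ hP hirr.ne_zero hf
  have hne := restrictMu_spectralRes_coeff_ne_zero P Q hP
  have hco := coeff_restrictMu_spectralRes P Q
  rw [e, map_mul, restrictMu_C, Polynomial.coeff_C_mul, restrictMu_constIncl,
    Polynomial.coeff_map] at hne hco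
  set b := (restrictMu (constants K) (f ^ r)).coeff P.order
  have hb : (b : K) ≠ 0 := right_ne_zero_of_mul hne
  have hb' : b ≠ 0 := by exact_mod_cast hb
  have ha : a = P.leadingCoeff ^ Q.order * ((-1) ^ P.order / (b : K)) := by
    rw [← mul_div_assoc, ← hco]
    exact (mul_div_cancel_right₀ a hb).symm
  refine ⟨MvPolynomial.C ((-1) ^ P.order / b) * f ^ r, ?_, ?_⟩
  · refine mul_ne_zero ?_ (pow_ne_zero _ hirr.ne_zero)
    rw [Ne, MvPolynomial.C_eq_zero]
    exact div_ne_zero (pow_ne_zero _ (neg_ne_zero.mpr one_ne_zero)) hb'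
  · rw [e, ha, constIncl_C_mul, MvPolynomial.smul_eq_C_mul, map_mul, mul_assoc]
    push_cast
    rfl

/-- The square-free parts of a power of an irreducible element are its associates. -/
theorem IsSquarefreePart.associated_of_pow {A : Type*} [CommRing A] [IsDomain A]
    {f p : A} {r : ℕ} (hr : r ≠ 0) (hp : Prime p) (h : IsSquarefreePart f (p ^ r)) :
    Associated f p := by
  obtain ⟨hsq, hdvd, k, hk⟩ := h
  obtain ⟨i, -, hi⟩ := (dvd_prime_pow hp r).mp hdvd
  refine associated_of_dvd_dvd ?_ (hp.dvd_of_dvd_pow ((dvd_pow_self p hr).trans hk))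
  rcases Nat.lt_or_ge i 2 with h2 | h2
  · exact hi.dvd.trans (pow_dvd_pow p (by omega : i ≤ 1) |>.trans (pow_one p).dvd)
  · exact absurd (hsq p (by rw [← sq]; exact (pow_dvd_pow p h2).trans hi.symm.dvd)) hp.not_isUnit

theorem IsSquarefreePart.congr_right {A : Type*} [CommRing A] {f g h : A}
    (hf : IsSquarefreePart f g) (hgh : Associated g h) : IsSquarefreePart f h :=
  ⟨hf.1, hf.2.1.trans hgh.dvd, hf.2.2.imp fun _ hk => hgh.symm.dvd.trans hk⟩

theorem differentialIdeal_eq_span_of_deriv_eq_zero {A : Type*} [CommRing A] [Differential A]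
    {f : A} (hf : f′ = 0) : differentialIdeal f = Ideal.span {f} := by
  refine le_antisymm (sInf_le ⟨Ideal.mem_span_singleton_self f, fun x hx => ?_⟩)
    (le_sInf fun I hI => (Ideal.span_singleton_le_iff_mem I).mpr hI.1)
  obtain ⟨a, rfl⟩ := Ideal.mem_span_singleton'.mp hx
  rw [Derivation.leibniz, hf, smul_zero, zero_add, smul_eq_mul]
  exact Ideal.mul_mem_right _ _ (Ideal.mem_span_singleton_self f)

end

end

theorem theoremB {K : Type*} [Field K] [CharZero K] [Differential K] [IsAlgClosed (constants K)]
    (P Q : DiffOp K) (hPQ : Commute P Q)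
    (hP : ¬ P.HasConstCoeffs) (hQ : ¬ Q.HasConstCoeffs)
    (hP0 : 0 < P.order) (hQ0 : 0 < Q.order) :
    (∃ h₀ : MvPolynomial (Fin 2) (constants K), h₀ ≠ 0 ∧
      spectralRes P Q = MvPolynomial.C (P.leadingCoeff ^ Q.order) * constIncl K h₀) ∧
    ∀ (c : K) (h₀ : MvPolynomial (Fin 2) (constants K)), c ≠ 0 →
      spectralRes P Q = MvPolynomial.C c * constIncl K h₀ →
      (∃ f, IsSquarefreePart f h₀) ∧
      ∀ f : MvPolynomial (Fin 2) (constants K), IsSquarefreePart f h₀ →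
        Irreducible f ∧
        bcIdeal P Q hPQ = Ideal.span {f} ∧
        (elimIdealConst P Q).radical = Ideal.span {f} ∧
        (elimIdeal P Q).radical = differentialIdeal (constIncl K f) ∧
        differentialIdeal (constIncl K f) = Ideal.span {constIncl K f} := by
  refine ⟨exists_spectralRes_eq_leadingCoeff_pow_mul hPQ hP0, fun c h₀ hc e => ?_⟩
  obtain ⟨p, hirr, hp⟩ := exists_bcIdeal_eq_span hPQ hP0
  obtain ⟨a, r, ha, hr, ea⟩ := exists_spectralRes_eq_pow hPQ hP0 hirr.ne_zero hp
  -- Whatever the factor `c`, `h₀` agrees with `pʳ` up to a nonzero constant, so its square-free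
  -- parts are the associates of `p`.
  have hassoc : Associated h₀ (p ^ r) := associated_of_C_mul_constIncl_eq hc ha
    (pow_ne_zero r hirr.ne_zero) (e.symm.trans ea)
  refine ⟨⟨p, hirr.squarefree, (dvd_pow_self p hr).trans hassoc.symm.dvd, r, hassoc.dvd⟩,
    fun f hf => ?_⟩
  have hfp := (hf.congr_right hassoc).associated_of_pow hr hirr.prime
  have hbc : bcIdeal P Q hPQ = Ideal.span {f} :=
    hp.trans (Ideal.span_singleton_eq_span_singleton.mpr hfp.symm)
  have hd := differentialIdeal_eq_span_of_deriv_eq_zero (deriv_constIncl f)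
  refine ⟨hfp.symm.irreducible hirr, hbc, ?_, ?_, hd⟩
  · rw [elimIdealConst_eq_bcIdeal P Q hPQ, (isPrime_bcIdeal hPQ hP0).radical, hbc]
  · rw [(isPrime_elimIdeal hPQ hP0).radical, hd, elimIdeal_eq_span hPQ hP0 hbc]
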